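/- **Setting.** Let $(W,S)$ be a finite Coxeter group with length function $\ell$ and longest element $w_0$. Let $\Gamma$ be a totally ordered abelian group, and let $A=\bigoplus_{\gamma\in\Gamma}\mathbb{Z}v^\gamma$ be its group ring, with involution $\overline{v^\gamma}=v^{-\gamma}$. For $0\neq a\in A$ let $\deg a$ be the largest $\gamma$ such that $v^\gamma$ occurs in $a$, and put $\deg 0=-\infty$. Let $L:W\to\Gamma$ satisfy $L(ww')=L(w)+L(w')$ whenever $\ell(ww')=\ell(w)+\ell(w')$, and $L(s)>0$ for $s\in S$. Let $\mathcal H$ be the Hecke algebra: the $A$-algebra with basis $(T_w)_{w\in W}$ such that $T_wT_{w'}=T_{ww'}$ if $\ell(ww')=\ell(w)+\ell(w')$, and $T_s^2=1+(v^{L(s)}-v^{-L(s)})T_s$ for $s\in S$. Put $\overline{\sum_w a_wT_w}=\sum_w\overline{a_w}\,T_{w^{-1}}^{-1}$. Let $(C_w)_{w\in W}$ be the Kazhdan–Lusztig basis: $C_w$ is the unique element with $\overline{C_w}=C_w$ and $C_w\in T_w+\bigoplus_y A_{<0}T_y$, where $A_{<0}=\{a\in A:\deg a<0\}$. Write $C_w=\sum_y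 p^*_{y,w}T_y$ and $C_xC_y=\sum_z h_{x,y,z}C_z$. Define $$\mathbf a(z)=\max_{x,y\in W}\deg h_{x,y,z},\qquad \Delta(z)=-\deg p^*_{1,z},$$ and let $\gamma_{x,y,z^{-1}}\in\mathbb{Z}$ be the coefficient of $v^{\mathbf a(z)}$ in $h_{x,y,z}$. Let $\leqslant_{\mathcal L}$ be the reflexive transitive closure of the relation "$C_z$ occurs with nonzero coefficient in $C_sC_{z'}$ for some $s\in S$" between $z$ and $z'$. Let $\leqslant_{\mathcal{LR}}$ be the reflexive transitive closure of the relation "$C_z$ occurs in $C_sC_{z'}$ or in $C_{z'}C_s$ for some $s\in S$". Write $x\sim_{\mathcal L}y$ if $x\leqslant_{\mathcal L}y$ and $y\leqslant_{\mathcal L}x$, and $x<_{\mathcal L}y$ if $x\leqslant_{\mathcal L}y$ and $x\not\sim_{\mathcal L}y$. **Proposition.** Assume that $(W,S,L)$ satisfies the following of Lusztig's conjectures: * $P_1$: $\mathbf a(z)\leqslant\Delta(z)$ for all $z\in W$; * $P_4$: if $z'\leqslant_{\mathcal{LR}}z$, then $\mathbf a(z)\leqslant\mathbf a(z')$; * $P_8$: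 if $\gamma_{x,y,z}\neq0$, then $x\sim_{\mathcal L}y^{-1}$, $y\sim_{\mathcal L}z^{-1}$ and $z\sim_{\mathcal L}x^{-1}$. For $n\in\mathbb Z$ and $y\in W$ write $T_{w_0}^nC_y=\sum_{x\in W}\lambda^{(n)}_{x,y}C_x$. Then for all $n\in\mathbb Z$ and $x,y\in W$: (a) If $n\geqslant0$, then $\deg\lambda^{(n)}_{x,y}\leqslant n(\mathbf a(x)-\mathbf a(w_0x))$, and the inequality is strict if $x<_{\mathcal L}y$. (b) If $n\leqslant0$, then $\deg\lambda^{(n)}_{x,y}\leqslant n(\mathbf a(y)-\mathbf a(w_0y))$, and the inequality is strict if $x<_{\mathcal L}y$. (c) If $n$ is even and $x\sim_{\mathcal L}y$, then $\lambda^{(n)}_{x,y}=\delta_{x,y}\,v^{n(\mathbf a(x)-\mathbf a(w_0x))}$. -/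

import Mathlib

set_option linter.unusedSectionVars false

namespace HeckeKL

section Exchange

variable {B W : Type*} [Group W] {M : CoxeterMatrix B} (cs : CoxeterSystem M W)

open Classical in
/-- The action of a simple reflection on `W × ℤ/2` which keeps track of the parity of inversions. -/
noncomputable def parityStep (i : B) : Function.End (W × ZMod 2) :=
  fun p => (cs.simple i * p.1 * cs.simple i, p.2 + if p.1 = cs.simple i then 1 else 0)

theorem end_mul_apply {α : Type*} (f g : Function.End α) (p : α) : (f * g) p = f (g p) := rfl

theorem end_one_apply {α : Type*} (p : α) : (1 : Function.End α) p = p := rfl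

open Classical in
theorem parityStep_word (ω : List B) (p : W × ZMod 2) :
    (ω.map (parityStep cs)).prod p
      = (cs.wordProd ω * p.1 * (cs.wordProd ω)⁻¹,
          p.2 + ((cs.rightInvSeq ω).count p.1 : ZMod 2)) := by
  induction ω with
  | nil => simp [end_one_apply]
  | cons i ω ih =>
    rw [List.map_cons, List.prod_cons, end_mul_apply, ih]
    simp only [parityStep, CoxeterSystem.wordProd_cons, mul_inv_rev, CoxeterSystem.inv_simple,
      CoxeterSystem.rightInvSeq, List.count_cons, mul_assoc, Prod.mk.injEq, true_and]
    have : (cs.wordProd ω * (p.1 * (cs.wordProd ω)⁻¹) = cs.simple i) ↔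
        ((cs.wordProd ω)⁻¹ * (cs.simple i * cs.wordProd ω) = p.1) := by
      constructor
      · intro h; rw [← h]; group
      · intro h; rw [← h]; group
    by_cases h : (cs.wordProd ω)⁻¹ * (cs.simple i * cs.wordProd ω) = p.1
    · simp [this.2 h, h, add_assoc]
    · have h' : ¬ _ := fun x => h (this.1 x)
      rw [if_neg h', if_neg (by simpa using h)]
      simp

theorem parityStep_alternating (i j : B) (m : ℕ) :
    ((CoxeterSystem.alternatingWord i j (2 * m)).reverse.map (parityStep cs)).prod
      = (parityStep cs j * parityStep cs i) ^ m := by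
  induction m with
  | zero => simp [CoxeterSystem.alternatingWord]
  | succ m ih =>
    rw [show 2 * (m + 1) = 2 * m + 1 + 1 by ring, CoxeterSystem.alternatingWord_succ,
      CoxeterSystem.alternatingWord_succ, pow_succ', ← ih]
    simp [mul_assoc]

theorem parityStep_isLiftable : M.IsLiftable (parityStep cs) := by
  classical
  intro j i
  rw [← parityStep_alternating]
  funext p
  rw [parityStep_word, CoxeterSystem.rightInvSeq_reverse, List.count_reverse]
  have hw : cs.wordProd (CoxeterSystem.alternatingWord i j (2 * M j i)) = 1 := by
    rw [CoxeterSystem.prod_alternatingWord_eq_mul_pow]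
    simp [M.symmetric j i]
  have hl : cs.leftInvSeq (CoxeterSystem.alternatingWord i j (2 * M j i))
      = (List.range (2 * M j i)).map
          (fun k => cs.wordProd (CoxeterSystem.alternatingWord j i (2 * k + 1))) := by
    apply List.ext_getElem
    · simp
    · intro k h1 h2
      rw [cs.getElem_leftInvSeq_alternatingWord i j (M j i) k (by simpa using h2)]
      simp
  have hp : ∀ k, cs.wordProd (CoxeterSystem.alternatingWord j i (2 * (M j i + k) + 1))
      = cs.wordProd (CoxeterSystem.alternatingWord j i (2 * k + 1)) := by
    intro k
    rw [CoxeterSystem.prod_alternatingWord_eq_mul_pow,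
      CoxeterSystem.prod_alternatingWord_eq_mul_pow]
    have h1 : (2 * (M j i + k) + 1) / 2 = M j i + k := by omega
    have h2 : (2 * k + 1) / 2 = k := by omega
    simp [h1, h2, pow_add]
  have hc : (((cs.leftInvSeq (CoxeterSystem.alternatingWord i j (2 * M j i))).count p.1 : ℕ)
      : ZMod 2) = 0 := by
    rw [hl, two_mul, List.range_add, List.map_append, List.map_map, List.count_append]
    have : ((fun k => cs.wordProd (CoxeterSystem.alternatingWord j i (2 * k + 1))) ∘
        fun x => M j i + x) = fun k => cs.wordProd (CoxeterSystem.alternatingWord j i (2 * k + 1)) :=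
      funext hp
    rw [this]
    push_cast
    exact CharTwo.add_self_eq_zero _
  rw [hc, CoxeterSystem.wordProd_reverse, hw]
  simp [end_one_apply]

/-- A case of the exchange condition. -/
theorem exchange {w : W} {i j : B} (h1 : cs.length w < cs.length (cs.simple i * w))
    (h2 : cs.length w < cs.length (w * cs.simple j))
    (h3 : cs.length (cs.simple i * w * cs.simple j) < cs.length (cs.simple i * w)) :
    cs.simple i * w = w * cs.simple j := by
  classical
  set φ := cs.lift ⟨parityStep cs, parityStep_isLiftable cs⟩ with hφ
  have hword : ∀ ω : List B, φ (cs.wordProd ω) = (ω.map (parityStep cs)).prod := by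
    intro ω
    rw [CoxeterSystem.wordProd, map_list_prod, List.map_map]
    congr 1
    apply List.map_congr_left
    intro i _
    exact cs.lift_apply_simple _ i
  obtain ⟨ω, hω, rfl⟩ := cs.exists_isReduced w
  have hr1 : cs.IsReduced (i :: ω) := by
    have h := cs.length_wordProd_le (i :: ω)
    unfold CoxeterSystem.IsReduced at hω ⊢
    rw [cs.wordProd_cons] at h ⊢
    rw [List.length_cons] at h ⊢
    omega
  obtain ⟨ω', hω', he⟩ := cs.exists_isReduced (cs.simple i * cs.wordProd ω * cs.simple j)
  -- the inversion sequence of a reduced word for `s w t` does not contain `t`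
  have hn : cs.simple j ∉ cs.rightInvSeq ω' := by
    intro hm
    have := (cs.isRightInversion_of_mem_rightInvSeq hω' hm).2
    rw [← he] at this
    simp only [CoxeterSystem.simple_mul_simple_cancel_right] at this
    omega
  have hk : cs.wordProd (i :: ω) = cs.wordProd (ω' ++ [j]) := by
    rw [cs.wordProd_append, ← he, cs.wordProd_cons]
    simp
  have hcount := congrFun ((hword (i :: ω)).symm.trans ((congrArg φ hk).trans (hword _)))
    (cs.simple j, 0)
  rw [parityStep_word, List.map_append, List.prod_append, end_mul_apply] at hcount
  simp only [List.map_cons, List.map_nil, List.prod_cons, List.prod_nil, mul_one] at hcount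
  have hstep : parityStep cs j (cs.simple j, 0) = (cs.simple j, 1) := by
    simp [parityStep]
  rw [hstep, parityStep_word] at hcount
  have hc2 := congrArg Prod.snd hcount
  simp only [List.count_eq_zero.2 hn, Nat.cast_zero, add_zero, zero_add] at hc2
  have hmem : cs.simple j ∈ cs.rightInvSeq (i :: ω) := by
    by_contra hno
    rw [List.count_eq_zero.2 hno] at hc2
    simp at hc2
  rw [CoxeterSystem.rightInvSeq, List.mem_cons] at hmem
  rcases hmem with hmem | hmem
  · rw [hmem]; group
  · have := (cs.isRightInversion_of_mem_rightInvSeq hω hmem).2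
    omega

end Exchange

section Coefficients

variable {Γ : Type*} [AddCommGroup Γ] [LinearOrder Γ]

/-- The group ring `A = ℤ[Γ]` of `Γ`, written exponentially. -/
abbrev Coeff (Γ : Type*) [AddCommGroup Γ] := AddMonoidAlgebra ℤ Γ

/-- The element `v ^ γ` of `A`. -/
noncomputable def v (γ : Γ) : Coeff Γ := AddMonoidAlgebra.single γ 1

/-- The degree of an element of `A`, with `deg 0 = -∞`. -/
noncomputable def deg (a : Coeff Γ) : WithBot Γ := a.coeff.support.max

/-- The ring automorphism `v ^ γ ↦ v ^ (-γ)` of `A`. -/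
noncomputable def barA : Coeff Γ ≃ₐ[ℤ] Coeff Γ :=
  AddMonoidAlgebra.domCongr ℤ ℤ (AddEquiv.neg Γ)

theorem barA_coeff (a : Coeff Γ) (γ : Γ) : (barA a).coeff γ = a.coeff (-γ) := by
  simp [barA, AddMonoidAlgebra.coeff_domCongr]

theorem barA_barA (a : Coeff Γ) : barA (barA a) = a := by
  ext γ
  simp [barA_coeff]

theorem barA_v (γ : Γ) : barA (v γ) = v (-γ) := by
  simp [barA, v]

theorem deg_lt_zero_iff (a : Coeff Γ) : deg a < 0 ↔ ∀ γ, 0 ≤ γ → a.coeff γ = 0 := by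
  unfold deg
  have : ((0 : WithBot Γ)) = ((0 : Γ) : WithBot Γ) := rfl
  rw [this, Finset.max, Finset.sup_lt_iff (WithBot.bot_lt_coe _)]
  constructor
  · intro h γ hγ
    by_contra hne
    exact absurd (WithBot.coe_lt_coe.1 (h γ (Finsupp.mem_support_iff.2 hne))) (not_lt.2 hγ)
  · intro h γ hγ
    refine WithBot.coe_lt_coe.2 (lt_of_not_ge fun hle => ?_)
    exact Finsupp.mem_support_iff.1 hγ (h γ hle)

theorem deg_add_lt_zero {a b : Coeff Γ} (ha : deg a < 0) (hb : deg b < 0) : deg (a + b) < 0 := by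
  rw [deg_lt_zero_iff] at *
  intro γ hγ
  simp [ha γ hγ, hb γ hγ]

theorem deg_sub_lt_zero {a b : Coeff Γ} (ha : deg a < 0) (hb : deg b < 0) : deg (a - b) < 0 := by
  rw [deg_lt_zero_iff] at *
  intro γ hγ
  have h : (a - b).coeff = a.coeff - b.coeff := rfl
  simp [h, ha γ hγ, hb γ hγ]

/-- Minus the part of negative degree. -/
noncomputable def negPart (a : Coeff Γ) : Coeff Γ :=
  .ofCoeff (-(a.coeff.filter (fun γ => γ < 0)))

theorem negPart_zero : negPart (0 : Coeff Γ) = 0 := by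
  ext γ
  simp [negPart, Finsupp.filter_apply]

theorem deg_negPart (a : Coeff Γ) : deg (negPart a) < 0 := by
  rw [deg_lt_zero_iff]
  intro γ hγ
  simp [negPart, not_lt.2 hγ]

variable [IsOrderedAddMonoid Γ]

theorem bar_negPart {a : Coeff Γ} (ha : barA a = -a) : barA (negPart a) - negPart a = a := by
  have hc : ∀ γ, a.coeff (-γ) = - a.coeff γ := by
    intro γ
    rw [← barA_coeff, ha]
    rfl
  ext γ
  have h : (barA (negPart a) - negPart a).coeff γ
    = (barA (negPart a)).coeff γ - (negPart a).coeff γ := rfl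
  rw [h, barA_coeff]
  simp only [negPart, AddMonoidAlgebra.coeff_ofCoeff, Finsupp.neg_apply, Finsupp.filter_apply,
    Left.neg_neg_iff]
  rcases lt_trichotomy γ 0 with h | h | h
  · simp [h, not_lt.2 h.le]
  · subst h
    have := hc 0
    rw [neg_zero] at this
    simp only [lt_irrefl, if_false]
    omega
  · simp [h, not_lt.2 h.le, hc]

theorem eq_zero_of_bar {a : Coeff Γ} (ha : barA a = a) (hd : deg a < 0) : a = 0 := by
  rw [deg_lt_zero_iff] at hd
  ext γ
  rcases le_total 0 γ with h | h
  · simpa using hd γ h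
  · rw [← ha, barA_coeff]
    simpa using hd (-γ) (by simpa using h)

end Coefficients

section Hecke

variable {B W : Type*} [Group W] {M : CoxeterMatrix B}

/-- A weight function on `(W, S)` which is positive on `S`. -/
structure WeightFunction (cs : CoxeterSystem M W) (Γ : Type*) [AddCommGroup Γ] [LinearOrder Γ] where
  /-- The underlying function. -/
  toFun : W → Γ
  map_mul : ∀ w w' : W, cs.length (w * w') = cs.length w + cs.length w' →
    toFun (w * w') = toFun w + toFun w'
  pos : ∀ i : B, 0 < toFun (cs.simple i)

variable {cs : CoxeterSystem M W} {Γ : Type*} [AddCommGroup Γ] [LinearOrder Γ]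
  (L : WeightFunction cs Γ)

/-- The parameter `v ^ L(s) - v ^ (-L(s))` attached to a simple reflection `s`. -/
noncomputable def param (i : B) : Coeff Γ :=
  v (L.toFun (cs.simple i)) - v (-L.toFun (cs.simple i))

theorem barA_param (i : B) : barA (param L i) = -param L i := by
  simp [param, barA_v]

variable (W Γ) in
/-- The free `A`-module with basis indexed by `W`. -/
def FreeMod : Type _ := W →₀ Coeff Γ

noncomputable instance : AddCommGroup (FreeMod W Γ) := inferInstanceAs (AddCommGroup (W →₀ Coeff Γ))

noncomputable instance : Module (Coeff Γ) (FreeMod W Γ) :=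
  inferInstanceAs (Module (Coeff Γ) (W →₀ Coeff Γ))

variable (W Γ) in
/-- The canonical basis of the free module. -/
noncomputable def e : Module.Basis W (Coeff Γ) (FreeMod W Γ) :=
  Module.Basis.ofRepr (LinearEquiv.refl (Coeff Γ) (W →₀ Coeff Γ))

/-- Left multiplication by `T_s` on the free `A`-module with basis `W`: it sends `w` to `s w` if
`ℓ(s w) > ℓ(w)`, and to `s w + (v ^ L(s) - v ^ (-L(s))) w` otherwise. -/
noncomputable def leftOp (i : B) : Module.End (Coeff Γ) (FreeMod W Γ) :=
  (e W Γ).constr (Coeff Γ) fun w : W => e W Γ (cs.simple i * w) +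
    if cs.length (cs.simple i * w) < cs.length w then param L i • e W Γ w else 0

/-- Right multiplication by `T_s` on the free `A`-module with basis `W`. -/
noncomputable def rightOp (i : B) : Module.End (Coeff Γ) (FreeMod W Γ) :=
  (e W Γ).constr (Coeff Γ) fun w : W => e W Γ (w * cs.simple i) +
    if cs.length (w * cs.simple i) < cs.length w then param L i • e W Γ w else 0

/-- The Hecke algebra `H(W, S, L)`, realized as the algebra of operators on the free `A`-module with
basis `W` generated by the left multiplications by the `T_s`. The facts `T_mul_T` and `T_simple_sq`
below, together with the basis `T`, show that this is the `A`-algebra with basis `(T_w)` and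
multiplication determined by `T_w T_w' = T_{ww'}` if `ℓ(ww') = ℓ(w) + ℓ(w')`, and
`T_s ^ 2 = 1 + (v ^ L(s) - v ^ (-L(s))) T_s`. -/
noncomputable def heckeAlgebra : Subalgebra (Coeff Γ) (Module.End (Coeff Γ) (FreeMod W Γ)) :=
  Algebra.adjoin (Coeff Γ) (Set.range (leftOp L))

/-- The type of elements of the Hecke algebra. -/
abbrev Hecke := ↥(heckeAlgebra L)

theorem leftOp_e (i : B) (w : W) : leftOp L i (e W Γ w) = e W Γ (cs.simple i * w) +
    if cs.length (cs.simple i * w) < cs.length w then param L i • e W Γ w else 0 := by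
  rw [leftOp, Module.Basis.constr_basis]

theorem rightOp_e (i : B) (w : W) : rightOp L i (e W Γ w) = e W Γ (w * cs.simple i) +
    if cs.length (w * cs.simple i) < cs.length w then param L i • e W Γ w else 0 := by
  rw [rightOp, Module.Basis.constr_basis]

theorem length_cases (w : W) (i j : B) : cs.simple i * w = w * cs.simple j ∨
    ((cs.length (cs.simple i * w * cs.simple j) < cs.length (w * cs.simple j) ↔
        cs.length (cs.simple i * w) < cs.length w) ∧
      (cs.length (cs.simple i * w * cs.simple j) < cs.length (cs.simple i * w) ↔
        cs.length (w * cs.simple j) < cs.length w)) := by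
  by_cases he : cs.simple i * w = w * cs.simple j
  · exact Or.inl he
  right
  have a1 := cs.length_simple_mul w i
  have a2 := cs.length_mul_simple w j
  have a3 := cs.length_mul_simple (cs.simple i * w) j
  have a4 := cs.length_simple_mul (w * cs.simple j) i
  rw [← mul_assoc] at a4
  have e1 : cs.length w < cs.length (cs.simple i * w) → cs.length w < cs.length (w * cs.simple j) →
      ¬ cs.length (cs.simple i * w * cs.simple j) < cs.length (cs.simple i * w) :=
    fun h1 h2 h3 => he (exchange cs h1 h2 h3)
  have e2 : cs.length (w * cs.simple j) < cs.length w →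
      cs.length (w * cs.simple j) < cs.length (cs.simple i * w * cs.simple j) →
      ¬ cs.length (cs.simple i * w) < cs.length (cs.simple i * w * cs.simple j) := by
    intro h1 h2 h3
    have := exchange cs (w := w * cs.simple j) (i := i) (j := j)
      (by rwa [← mul_assoc]) (by simpa using h1) (by simpa [← mul_assoc] using h3)
    apply he
    rw [CoxeterSystem.simple_mul_simple_cancel_right, ← mul_assoc] at this
    conv_rhs => rw [← this]
    simp
  omega

theorem weight_eq {w : W} {i j : B} (h : cs.simple i * w = w * cs.simple j) :
    L.toFun (cs.simple i) = L.toFun (cs.simple j) := by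
  rcases cs.length_simple_mul w i with h1 | h1
  · have e1 := L.map_mul (cs.simple i) w (by rw [cs.length_simple]; omega)
    have e2 := L.map_mul w (cs.simple j) (by rw [cs.length_simple, ← h]; omega)
    rw [← h, e1, add_comm] at e2
    exact add_left_cancel e2
  · have e1 := L.map_mul (cs.simple i) (cs.simple i * w)
      (by rw [cs.length_simple, CoxeterSystem.simple_mul_simple_cancel_left]; omega)
    have e2 := L.map_mul (w * cs.simple j) (cs.simple j)
      (by rw [cs.length_simple, CoxeterSystem.simple_mul_simple_cancel_right, ← h]; omega)
    rw [CoxeterSystem.simple_mul_simple_cancel_left] at e1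
    rw [CoxeterSystem.simple_mul_simple_cancel_right, ← h, e1, add_comm] at e2
    exact add_left_cancel e2

theorem leftOp_rightOp_comm (i j : B) : leftOp L i * rightOp L j = rightOp L j * leftOp L i := by
  apply (e W Γ).ext
  intro w
  simp only [Module.End.mul_apply, leftOp_e, rightOp_e, map_add, apply_ite (leftOp L i),
    apply_ite (rightOp L j), map_smul, map_zero]
  rw [← mul_assoc]
  rcases length_cases w i j with h | ⟨h1, h2⟩
  · have hq : param L i = param L j := by
      unfold param
      rw [weight_eq L h]
    rw [← h, hq]
  · simp only [h1, h2]
    split_ifs <;> module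

/-- Evaluation at the base vector `1 ∈ W`. -/
noncomputable def evalOne : Hecke L →ₗ[Coeff Γ] FreeMod W Γ where
  toFun f := f.1 (e W Γ 1)
  map_add' _ _ := rfl
  map_smul' _ _ := rfl

/-- The generator of the Hecke algebra given by left multiplication by a simple reflection. -/
noncomputable def gen (i : B) : Hecke L := ⟨leftOp L i, Algebra.subset_adjoin ⟨i, rfl⟩⟩

theorem evalOne_gen_mul (i : B) (f : Hecke L) : evalOne L (gen L i * f) = leftOp L i (evalOne L f) :=
  rfl

theorem hecke_comm_right (f : Hecke L) (j : B) : f.1 * rightOp L j = rightOp L j * f.1 := by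
  have := Algebra.adjoin_le (S := Subalgebra.centralizer (Coeff Γ) {rightOp L j})
    (s := Set.range (leftOp L)) (by
      rintro _ ⟨i, rfl⟩
      rw [SetLike.mem_coe, Subalgebra.mem_centralizer_iff]
      rintro _ rfl
      exact (leftOp_rightOp_comm L i j).symm) f.2
  exact ((Subalgebra.mem_centralizer_iff _).1 this _ rfl).symm

theorem exists_descent {w : W} (hw : w ≠ 1) : ∃ (i : B) (u : W), w = cs.simple i * u ∧
    cs.length w = cs.length u + 1 := by
  obtain ⟨i, hi⟩ := cs.exists_leftDescent_of_ne_one hw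
  refine ⟨i, cs.simple i * w, by simp, ?_⟩
  have := cs.isLeftDescent_iff.1 hi
  omega

variable (cs) in
theorem length_induction {p : W → Prop} (one : p 1)
    (step : ∀ (i : B) (u : W), cs.length (cs.simple i * u) = cs.length u + 1 → p u →
      p (cs.simple i * u)) (w : W) : p w := by
  induction hn : cs.length w generalizing w with
  | zero => rw [cs.length_eq_zero_iff.1 hn]; exact one
  | succ n ih =>
    have hw : w ≠ 1 := by
      rintro rfl
      simp at hn
    obtain ⟨i, u, rfl, hu⟩ := exists_descent (cs := cs) hw
    exact step i u hu (ih u (by omega))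

theorem exists_evalOne (w : W) : ∃ f : Hecke L, evalOne L f = e W Γ w := by
  induction w using length_induction cs with
  | one => exact ⟨1, rfl⟩
  | step i u hu ih =>
    obtain ⟨f, hf⟩ := ih
    refine ⟨gen L i * f, ?_⟩
    rw [evalOne_gen_mul, hf, leftOp_e, if_neg (by omega), add_zero]

theorem evalOne_bijective : Function.Bijective (evalOne L) := by
  constructor
  · rw [injective_iff_map_eq_zero]
    intro f hf
    have key : ∀ w : W, f.1 (e W Γ w⁻¹) = 0 := by
      intro w
      induction w using length_induction cs with
      | one => rw [inv_one]; exact hf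
      | step i u hu ih =>
        have h1 : rightOp L i (e W Γ u⁻¹) = e W Γ (cs.simple i * u)⁻¹ := by
          rw [rightOp_e, if_neg, add_zero]
          · simp
          · have e : u⁻¹ * cs.simple i = (cs.simple i * u)⁻¹ := by simp
            rw [e, cs.length_inv, cs.length_inv]
            omega
        have h2 := congrArg (fun g => g (e W Γ u⁻¹)) (hecke_comm_right L f i)
        simp only [Module.End.mul_apply] at h2
        rw [← h1, h2, ih, map_zero]
    apply Subtype.ext
    apply (e W Γ).ext
    intro w
    rw [← inv_inv w]
    exact key w⁻¹
  · rw [← LinearMap.range_eq_top, eq_top_iff, ← (e W Γ).span_eq, Submodule.span_le]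
    rintro _ ⟨w, rfl⟩
    exact exists_evalOne L w

/-- The standard basis `(T_w)` of the Hecke algebra. -/
noncomputable def T : Module.Basis W (Coeff Γ) (Hecke L) :=
  (e W Γ).map (LinearEquiv.ofBijective (evalOne L) (evalOne_bijective L)).symm

theorem evalOne_T (w : W) : evalOne L (T L w) = e W Γ w := by
  rw [T, Module.Basis.map_apply]
  exact LinearEquiv.apply_symm_apply (LinearEquiv.ofBijective (evalOne L) (evalOne_bijective L)) _

theorem gen_mul_T (i : B) (w : W) : gen L i * T L w = T L (cs.simple i * w) +
    if cs.length (cs.simple i * w) < cs.length w then param L i • T L w else 0 := by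
  apply (evalOne_bijective L).1
  rw [evalOne_gen_mul, evalOne_T, leftOp_e, map_add, evalOne_T]
  split_ifs
  · rw [map_smul, evalOne_T]
  · rw [map_zero]

theorem gen_mul_T_up {i : B} {u : W} (h : cs.length (cs.simple i * u) = cs.length u + 1) :
    gen L i * T L u = T L (cs.simple i * u) := by
  rw [gen_mul_T, if_neg (by omega), add_zero]

theorem T_one : T L 1 = 1 := by
  apply (evalOne_bijective L).1
  rw [evalOne_T]
  rfl

theorem T_simple (i : B) : T L (cs.simple i) = gen L i := by
  have := gen_mul_T_up L (i := i) (u := 1) (by simp)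
  rw [T_one] at this
  simpa using this.symm

/-- `T_w T_w' = T_{ww'}` if `ℓ(ww') = ℓ(w) + ℓ(w')`. -/
theorem T_mul_T (w w' : W) (h : cs.length (w * w') = cs.length w + cs.length w') :
    T L w * T L w' = T L (w * w') := by
  induction w using length_induction cs with
  | one => simp [T_one]
  | step i u hu ih =>
    have h1 := cs.length_mul_le u w'
    have h2 := cs.length_simple_mul (u * w') i
    rw [mul_assoc] at h
    rw [← gen_mul_T_up L hu, mul_assoc, ih (by omega), gen_mul_T_up L (by omega), mul_assoc]

/-- `T_s ^ 2 = 1 + (v ^ L(s) - v ^ (-L(s))) T_s`. -/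
theorem T_simple_sq (i : B) : T L (cs.simple i) ^ 2 = 1 + param L i • T L (cs.simple i) := by
  have := gen_mul_T L i (cs.simple i)
  rw [← T_simple] at this
  rw [sq, this]
  simp [T_one]

theorem gen_mul_inv (i : B) : gen L i * (gen L i - param L i • 1) = 1 := by
  have := T_simple_sq L i
  rw [T_simple, sq] at this
  rw [mul_sub, this, mul_smul_comm, mul_one]
  abel

theorem gen_inv_mul (i : B) : (gen L i - param L i • 1) * gen L i = 1 := by
  have := T_simple_sq L i
  rw [T_simple, sq] at this
  rw [sub_mul, this, smul_mul_assoc, one_mul]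
  abel

theorem isUnit_T (w : W) : IsUnit (T L w) := by
  induction w using length_induction cs with
  | one => rw [T_one]; exact isUnit_one
  | step i u hu ih =>
    rw [← gen_mul_T_up L hu]
    exact IsUnit.mul ⟨⟨gen L i, _, gen_mul_inv L i, gen_inv_mul L i⟩, rfl⟩ ih

/-- `T_w` as a unit of the Hecke algebra. -/
noncomputable def TUnit (w : W) : (Hecke L)ˣ := (isUnit_T L w).unit

theorem TUnit_val (w : W) : (TUnit L w : Hecke L) = T L w := rfl

/-- The bar involution `∑ a_w T_w ↦ ∑ (bar a_w) T_{w⁻¹}⁻¹` of the Hecke algebra. -/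
noncomputable def bar (h : Hecke L) : Hecke L :=
  ((T L).repr h).sum fun w a => barA a • (((TUnit L w⁻¹)⁻¹ : (Hecke L)ˣ) : Hecke L)

theorem bar_add (h h' : Hecke L) : bar L (h + h') = bar L h + bar L h' := by
  unfold bar
  rw [map_add, Finsupp.sum_add_index']
  · intro w
    rw [map_zero, zero_smul]
  · intro w a b
    rw [map_add, add_smul]

theorem bar_smul (a : Coeff Γ) (h : Hecke L) : bar L (a • h) = barA a • bar L h := by
  unfold bar
  rw [map_smul, Finsupp.sum_smul_index', Finsupp.smul_sum]
  · simp only [smul_eq_mul, map_mul, mul_smul]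
  · intro w
    rw [map_zero, zero_smul]

theorem bar_zero : bar L 0 = 0 := by
  have := bar_smul L 0 0
  rwa [map_zero, zero_smul, zero_smul] at this

theorem bar_neg (h : Hecke L) : bar L (-h) = -bar L h := by
  rw [eq_neg_iff_add_eq_zero, ← bar_add, neg_add_cancel, bar_zero]

theorem bar_sub (h h' : Hecke L) : bar L (h - h') = bar L h - bar L h' := by
  rw [sub_eq_add_neg, bar_add, bar_neg, ← sub_eq_add_neg]

theorem bar_T (w : W) : bar L (T L w) = (((TUnit L w⁻¹)⁻¹ : (Hecke L)ˣ) : Hecke L) := by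
  unfold bar
  rw [Module.Basis.repr_self, Finsupp.sum_single_index]
  · rw [map_one, one_smul]
  · rw [map_zero, zero_smul]

theorem hecke_induction {p : Hecke L → Prop} (h0 : p 0) (hT : ∀ w, p (T L w))
    (hadd : ∀ x y, p x → p y → p (x + y)) (hsmul : ∀ (a : Coeff Γ) x, p x → p (a • x))
    (h : Hecke L) : p h := by
  have hm : h ∈ Submodule.span (Coeff Γ) (Set.range (T L)) := by
    rw [(T L).span_eq]
    trivial
  induction hm using Submodule.span_induction with
  | mem x hx =>
    obtain ⟨w, rfl⟩ := hx
    exact hT w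
  | zero => exact h0
  | add x y _ _ hx hy => exact hadd x y hx hy
  | smul a x _ hx => exact hsmul a x hx

theorem bar_T_one : bar L (T L 1) = T L 1 := by
  rw [bar_T]
  have h : TUnit L (1 : W)⁻¹ = 1 := by
    apply Units.ext
    rw [TUnit_val, inv_one, T_one]
    rfl
  rw [h, inv_one, T_one]
  rfl

theorem T_mul_gen {i : B} {u : W} (h : cs.length (cs.simple i * u) = cs.length u + 1) :
    T L u⁻¹ * gen L i = T L (cs.simple i * u)⁻¹ := by
  have e : u⁻¹ * cs.simple i = (cs.simple i * u)⁻¹ := by simp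
  rw [← T_simple, T_mul_T, e]
  rw [e, cs.length_inv, cs.length_inv, cs.length_simple, h]

theorem bar_T_up {i : B} {u : W} (h : cs.length (cs.simple i * u) = cs.length u + 1) :
    bar L (T L (cs.simple i * u)) = (gen L i - param L i • 1) * bar L (T L u) := by
  rw [bar_T, bar_T]
  have hu : TUnit L (cs.simple i * u)⁻¹ = TUnit L u⁻¹ *
      (⟨gen L i, gen L i - param L i • 1, gen_mul_inv L i, gen_inv_mul L i⟩ : (Hecke L)ˣ) := by
    apply Units.ext
    rw [Units.val_mul, TUnit_val, TUnit_val, T_mul_gen L h]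
  rw [hu, mul_inv_rev, Units.val_mul]
  rfl

theorem bar_gen_mul (i : B) (h : Hecke L) :
    bar L (gen L i * h) = (gen L i - param L i • 1) * bar L h := by
  induction h using hecke_induction with
  | h0 => rw [mul_zero, bar_zero, mul_zero]
  | hadd x y hx hy => rw [mul_add, bar_add, hx, hy, bar_add, mul_add]
  | hsmul a x hx => rw [mul_smul_comm, bar_smul, hx, bar_smul, mul_smul_comm]
  | hT w =>
    rcases cs.length_simple_mul w i with hl | hl
    · rw [gen_mul_T_up L hl, bar_T_up L hl]
    · have hup : cs.length (cs.simple i * (cs.simple i * w)) = cs.length (cs.simple i * w) + 1 := by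
        rw [CoxeterSystem.simple_mul_simple_cancel_left, hl]
      have h1 := bar_T_up L hup
      rw [CoxeterSystem.simple_mul_simple_cancel_left] at h1
      have h2 : gen L i * bar L (T L w) = bar L (T L (cs.simple i * w)) := by
        rw [h1, ← mul_assoc, gen_mul_inv, one_mul]
      rw [gen_mul_T, if_pos (by omega), bar_add, bar_smul, barA_param, sub_mul, h2,
        smul_mul_assoc, one_mul, neg_smul, ← sub_eq_add_neg]

theorem bar_bar (h : Hecke L) : bar L (bar L h) = h := by
  induction h using hecke_induction with
  | h0 => rw [bar_zero, bar_zero]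
  | hadd x y hx hy => rw [bar_add, bar_add, hx, hy]
  | hsmul a x hx => rw [bar_smul, bar_smul, hx, barA_barA]
  | hT w =>
    induction w using length_induction cs with
    | one => rw [bar_T_one, bar_T_one]
    | step i u hu ih =>
      rw [bar_T_up L hu, sub_mul, bar_sub, bar_gen_mul, ih, smul_mul_assoc, one_mul, bar_smul, ih,
        barA_param, ← gen_mul_T_up L hu, sub_mul, smul_mul_assoc, one_mul, neg_smul]
      abel

/-- The span of the `T_y` with `ℓ(y) < n`. -/
noncomputable def low (n : ℕ) : Submodule (Coeff Γ) (Hecke L) :=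
  Submodule.span (Coeff Γ) (T L '' {y | cs.length y < n})

theorem mem_low {n : ℕ} {h : Hecke L} :
    h ∈ low L n ↔ ∀ y, n ≤ cs.length y → (T L).repr h y = 0 := by
  unfold low
  rw [Module.Basis.mem_span_image]
  constructor
  · intro hs y hy
    by_contra hne
    have := hs (Finset.mem_coe.2 (Finsupp.mem_support_iff.2 hne))
    exact absurd this (not_lt.2 hy)
  · intro hs y hy
    by_contra hne
    exact Finsupp.mem_support_iff.1 (Finset.mem_coe.1 hy) (hs y (not_lt.1 hne))

theorem T_mem_low {n : ℕ} {w : W} (h : cs.length w < n) : T L w ∈ low L n :=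
  Submodule.subset_span ⟨w, h, rfl⟩

theorem low_mono {m n : ℕ} (h : m ≤ n) : low L m ≤ low L n :=
  Submodule.span_mono (Set.image_mono fun _ hy => lt_of_lt_of_le hy h)

theorem low_zero {h : Hecke L} (hh : h ∈ low L 0) : h = 0 := by
  apply (T L).ext_elem
  intro y
  rw [(mem_low L).1 hh y (Nat.zero_le _), map_zero]
  rfl

theorem exists_low (h : Hecke L) : ∃ n, h ∈ low L n := by
  refine ⟨((T L).repr h).support.sup cs.length + 1, (mem_low L).2 fun y hy => ?_⟩
  by_contra hne
  have := Finset.le_sup (f := cs.length) (Finsupp.mem_support_iff.2 hne)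
  omega

theorem gen_mul_low {n : ℕ} {h : Hecke L} (hh : h ∈ low L n) (i : B) :
    gen L i * h ∈ low L (n + 1) := by
  induction hh using Submodule.span_induction with
  | mem x hx =>
    obtain ⟨w, hw, rfl⟩ := hx
    have hw' : cs.length w < n := hw
    rw [gen_mul_T]
    refine Submodule.add_mem _ (T_mem_low L ?_) ?_
    · have := cs.length_simple_mul w i
      omega
    · split_ifs
      · exact Submodule.smul_mem _ _ (T_mem_low L (by omega))
      · exact Submodule.zero_mem _
  | zero => rw [mul_zero]; exact Submodule.zero_mem _
  | add x y _ _ hx hy => rw [mul_add]; exact Submodule.add_mem _ hx hy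
  | smul a x _ hx => rw [mul_smul_comm]; exact Submodule.smul_mem _ _ hx

theorem bar_T_sub (w : W) : bar L (T L w) - T L w ∈ low L (cs.length w) := by
  induction w using length_induction cs with
  | one => rw [bar_T_one, sub_self]; exact Submodule.zero_mem _
  | step i u hu ih =>
    have h : bar L (T L (cs.simple i * u)) - T L (cs.simple i * u) =
        gen L i * (bar L (T L u) - T L u) -
          param L i • (T L u + (bar L (T L u) - T L u)) := by
      rw [bar_T_up L hu, ← gen_mul_T_up L hu, sub_mul, smul_mul_assoc, one_mul, mul_sub,
        add_sub_cancel]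
      abel
    rw [h, hu]
    exact Submodule.sub_mem _ (gen_mul_low L ih i) (Submodule.smul_mem _ _ (Submodule.add_mem _
      (T_mem_low L (Nat.lt_succ_self _)) (low_mono L (Nat.le_succ _) ih)))

theorem repr_bar_top {n : ℕ} {h : Hecke L} (hh : h ∈ low L (n + 1)) {y : W}
    (hy : cs.length y = n) : (T L).repr (bar L h) y = barA ((T L).repr h y) := by
  classical
  induction hh using Submodule.span_induction with
  | mem x hx =>
    obtain ⟨w, hw, rfl⟩ := hx
    have hw' : cs.length w < n + 1 := hw
    have h1 := (mem_low L).1 (bar_T_sub L w) y (by omega)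
    rw [map_sub, Finsupp.sub_apply, sub_eq_zero] at h1
    rw [h1, Module.Basis.repr_self, Finsupp.single_apply]
    split_ifs
    · rw [map_one]
    · rw [map_zero]
  | zero => rw [bar_zero, map_zero, Finsupp.zero_apply, map_zero]
  | add x y _ _ hx hy =>
    rw [bar_add, map_add, Finsupp.add_apply, hx, hy, map_add, Finsupp.add_apply, map_add]
  | smul a x _ hx =>
    rw [bar_smul, map_smul, Finsupp.smul_apply, hx, map_smul, Finsupp.smul_apply, smul_eq_mul,
      smul_eq_mul, map_mul]

theorem bar_low {n : ℕ} {h : Hecke L} (hh : h ∈ low L n) : bar L h ∈ low L n := by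
  induction hh using Submodule.span_induction with
  | mem x hx =>
    obtain ⟨w, hw, rfl⟩ := hx
    have := Submodule.add_mem _ (low_mono L (le_of_lt hw) (bar_T_sub L w)) (T_mem_low L hw)
    rwa [sub_add_cancel] at this
  | zero => rw [bar_zero]; exact Submodule.zero_mem _
  | add x y _ _ hx hy => rw [bar_add]; exact Submodule.add_mem _ hx hy
  | smul a x _ hx => rw [bar_smul]; exact Submodule.smul_mem _ _ hx

section

variable [IsOrderedAddMonoid Γ]

theorem exists_bar_sub (n : ℕ) (h : Hecke L) (hh : h ∈ low L n) (hb : bar L h = -h) :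
    ∃ g ∈ low L n, (∀ y, deg ((T L).repr g y) < 0) ∧ bar L g - g = h := by
  induction n generalizing h with
  | zero =>
    refine ⟨0, Submodule.zero_mem _, fun y => ?_, ?_⟩
    · rw [map_zero, Finsupp.zero_apply, deg_lt_zero_iff]
      intro γ _
      rfl
    · rw [low_zero L hh, bar_zero, sub_zero]
  | succ n ih =>
    set g₀ : Hecke L := (T L).repr.symm (((T L).repr h).mapRange negPart negPart_zero) with hg₀
    have hc : ∀ y, (T L).repr g₀ y = negPart ((T L).repr h y) := by
      intro y
      rw [hg₀, LinearEquiv.apply_symm_apply, Finsupp.mapRange_apply]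
    have hgl : g₀ ∈ low L (n + 1) := by
      rw [mem_low] at hh ⊢
      intro y hy
      rw [hc, hh y hy, negPart_zero]
    have hd : ∀ y, deg ((T L).repr g₀ y) < 0 := fun y => by
      rw [hc]
      exact deg_negPart _
    have hl : h - (bar L g₀ - g₀) ∈ low L n := by
      rw [mem_low]
      intro y hy
      rcases eq_or_lt_of_le hy with hy | hy
      · rw [map_sub, map_sub, Finsupp.sub_apply, Finsupp.sub_apply, repr_bar_top L hgl hy.symm, hc,
          bar_negPart, sub_self]
        rw [← repr_bar_top L hh hy.symm, hb, map_neg, Finsupp.neg_apply]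
      · exact (mem_low L).1 (Submodule.sub_mem _ hh (Submodule.sub_mem _ (bar_low L hgl) hgl)) y hy
    obtain ⟨g, hg, hgd, he⟩ := ih (h - (bar L g₀ - g₀)) hl (by
      rw [bar_sub, bar_sub, bar_bar, hb]
      abel)
    refine ⟨g + g₀, Submodule.add_mem _ (low_mono L (Nat.le_succ _) hg) hgl, fun y => ?_, ?_⟩
    · rw [map_add, Finsupp.add_apply]
      exact deg_add_lt_zero (hgd y) (hd y)
    · rw [bar_add, add_sub_add_comm, he, sub_add_cancel]

theorem eq_zero_of_bar_eq {d : Hecke L} (hb : bar L d = d)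
    (hd : ∀ y, deg ((T L).repr d y) < 0) : d = 0 := by
  obtain ⟨n, hn⟩ := exists_low L d
  induction n with
  | zero => exact low_zero L hn
  | succ n ih =>
    apply ih
    rw [mem_low] at hn ⊢
    intro y hy
    rcases eq_or_lt_of_le hy with hy | hy
    · refine eq_zero_of_bar ?_ (hd y)
      rw [← repr_bar_top L ((mem_low L).2 hn) hy.symm, hb]
    · exact hn y hy

theorem exists_kl (w : W) : ∃ c : Hecke L, (bar L c = c ∧
    ∀ y, deg ((T L).repr (c - T L w) y) < 0) ∧ c - T L w ∈ low L (cs.length w) := by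
  obtain ⟨g, hg, hd, he⟩ := exists_bar_sub L (cs.length w) (T L w - bar L (T L w))
    (by
      rw [← neg_sub]
      exact Submodule.neg_mem _ (bar_T_sub L w))
    (by
      rw [bar_sub, bar_bar]
      abel)
  refine ⟨T L w + g, ⟨?_, fun y => ?_⟩, ?_⟩
  · rw [bar_add, eq_add_of_sub_eq he]
    abel
  · rw [add_sub_cancel_left]
    exact hd y
  · rwa [add_sub_cancel_left]

theorem existsUnique_kl (w : W) : ∃! c : Hecke L, bar L c = c ∧
    ∀ y, deg ((T L).repr (c - T L w) y) < 0 := by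
  obtain ⟨c, hc, _⟩ := exists_kl L w
  refine ⟨c, hc, fun c' hc' => ?_⟩
  apply sub_eq_zero.1
  apply eq_zero_of_bar_eq L
  · rw [bar_sub, hc.1, hc'.1]
  · intro y
    rw [← sub_sub_sub_cancel_right c' c (T L w), map_sub, Finsupp.sub_apply]
    exact deg_sub_lt_zero (hc'.2 y) (hc.2 y)

/-- The Kazhdan–Lusztig element `C_w`: the unique bar-invariant element of
`T_w + ⨁_y A_{<0} T_y`. -/
noncomputable def klElement (w : W) : Hecke L := (existsUnique_kl L w).choose

theorem klElement_spec (w : W) : bar L (klElement L w) = klElement L w ∧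
    ∀ y, deg ((T L).repr (klElement L w - T L w) y) < 0 :=
  (existsUnique_kl L w).choose_spec.1

theorem klElement_sub_mem_low (w : W) : klElement L w - T L w ∈ low L (cs.length w) := by
  obtain ⟨c, hc, hl⟩ := exists_kl L w
  rwa [(existsUnique_kl L w).unique (klElement_spec L w) hc]

theorem klElement_one : klElement L (1 : W) = 1 := by
  have h := klElement_sub_mem_low L (1 : W)
  rw [cs.length_one] at h
  rw [sub_eq_zero.1 (low_zero L h), T_one]

theorem low_le_span (n : ℕ) : low L n ≤ Submodule.span (Coeff Γ) (Set.range (klElement L)) := by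
  induction n with
  | zero =>
    intro h hh
    rw [low_zero L hh]
    exact Submodule.zero_mem _
  | succ n ih =>
    refine Submodule.span_le.2 ?_
    rintro _ ⟨y, hy, rfl⟩
    have hy' : cs.length y ≤ n := Nat.lt_succ_iff.1 hy
    have h1 := ih (low_mono L hy' (klElement_sub_mem_low L y))
    have h2 := Submodule.sub_mem _ (Submodule.subset_span (Set.mem_range_self y)) h1
    rwa [sub_sub_cancel] at h2

theorem span_klElement : ⊤ ≤ Submodule.span (Coeff Γ) (Set.range (klElement L)) := by
  intro h _
  obtain ⟨n, hn⟩ := exists_low L h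
  exact low_le_span L n hn

theorem linearIndependent_klElement : LinearIndependent (Coeff Γ) (klElement L) := by
  rw [linearIndependent_iff]
  intro l hl
  have key : ∀ n, (∀ w, n ≤ cs.length w → l w = 0) → l = 0 := by
    intro n
    induction n with
    | zero => exact fun h => Finsupp.ext fun w => h w (Nat.zero_le _)
    | succ n ih =>
      intro h
      apply ih
      intro w hw
      have hm : (T L).repr.symm l ∈ low L n := by
        have h1 : (T L).repr.symm l = -(l.sum fun u a => a • (klElement L u - T L u)) := by
          rw [Module.Basis.repr_symm_apply, ← neg_eq_iff_eq_neg, ← sub_eq_zero, ← neg_eq_zero,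
            ← hl, Finsupp.linearCombination_apply, Finsupp.linearCombination_apply,
            neg_sub, sub_neg_eq_add, ← Finsupp.sum_add]
          simp only [smul_sub, sub_add_cancel]
        rw [h1]
        refine Submodule.neg_mem _ (Submodule.sum_mem _ fun u hu => Submodule.smul_mem _ _ ?_)
        refine low_mono L ?_ (klElement_sub_mem_low L u)
        by_contra hlt
        exact Finsupp.mem_support_iff.1 hu (h u (by omega))
      have := (mem_low L).1 hm w hw
      rwa [LinearEquiv.apply_symm_apply] at this
  refine key (l.support.sup cs.length + 1) fun w hw => ?_
  by_contra hne
  have := Finset.le_sup (f := cs.length) (Finsupp.mem_support_iff.2 hne)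
  omega

/-- The Kazhdan–Lusztig basis `(C_w)` of the Hecke algebra. -/
noncomputable def C : Module.Basis W (Coeff Γ) (Hecke L) :=
  Module.Basis.mk (linearIndependent_klElement L) (span_klElement L)

theorem C_apply (w : W) : C L w = klElement L w := Module.Basis.mk_apply _ _ _

/-- The coefficient `p*_{y,w}` of `C_w = ∑_y p*_{y,w} T_y`. -/
noncomputable def pStar (y w : W) : Coeff Γ := (T L).repr (C L w) y

/-- The structure constants `h_{x,y,z}` of `C_x C_y = ∑_z h_{x,y,z} C_z`. -/
noncomputable def hCoeff (x y z : W) : Coeff Γ := (C L).repr (C L x * C L y) z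

/-- One step of the left preorder: `z ←_L z'` if `C_z` occurs in `C_s C_z'` for some `s ∈ S`. -/
def leftStep (z z' : W) : Prop := ∃ i : B, hCoeff L (cs.simple i) z' z ≠ 0

/-- One step of the right preorder: `z ←_R z'` if `C_z` occurs in `C_z' C_s` for some `s ∈ S`. -/
def rightStep (z z' : W) : Prop := ∃ i : B, hCoeff L z' (cs.simple i) z ≠ 0

/-- The preorder `≤_L`. -/
def leL (z z' : W) : Prop := Relation.ReflTransGen (leftStep L) z z'

/-- The preorder `≤_LR`. -/
def leLR (z z' : W) : Prop :=
  Relation.ReflTransGen (fun u u' => leftStep L u u' ∨ rightStep L u u') z z'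

/-- The equivalence relation `∼_L`, whose classes are the left cells. -/
def simL (z z' : W) : Prop := leL L z z' ∧ leL L z' z

/-- The strict relation `<_L`. -/
def ltL (z z' : W) : Prop := leL L z z' ∧ ¬ simL L z z'

variable [Fintype W]

theorem sup_deg_ne_bot (z : W) :
    (Finset.univ.sup fun p : W × W => deg (hCoeff L p.1 p.2 z)) ≠ ⊥ := by
  have h1 : hCoeff L 1 z z = 1 := by
    rw [hCoeff, C_apply, klElement_one, one_mul, Module.Basis.repr_self, Finsupp.single_eq_same]
  have h2 : deg (1 : Coeff Γ) ≠ ⊥ := by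
    unfold deg
    rw [Ne, Finset.max_eq_bot, Finsupp.support_eq_empty, AddMonoidAlgebra.coeff_eq_zero]
    exact one_ne_zero
  intro h
  have h3 := Finset.le_sup (f := fun p : W × W => deg (hCoeff L p.1 p.2 z))
    (Finset.mem_univ ((1, z) : W × W))
  rw [h, h1] at h3
  exact h2 (le_bot_iff.1 h3)

/-- The function `a(z) = max_{x,y} deg h_{x,y,z}`. -/
noncomputable def aFun (z : W) : Γ :=
  (Finset.univ.sup fun p : W × W => deg (hCoeff L p.1 p.2 z)).unbot (sup_deg_ne_bot L z)

/-- The integer `γ_{x,y,z}`: the coefficient of `v ^ a(z⁻¹)` in `h_{x,y,z⁻¹}`. -/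
noncomputable def gammaCoeff (x y z : W) : ℤ := (hCoeff L x y z⁻¹).coeff (aFun L z⁻¹)

/-- `Δ(z) = -deg p*_{1,z}`, with `-(-∞) = +∞`. -/
noncomputable def Delta (z : W) : WithTop Γ :=
  WithBot.recBotCoe (C := fun _ => WithTop Γ) ⊤ (fun γ => ((-γ : Γ) : WithTop Γ))
    (deg (pStar L 1 z))

/-- Lusztig's conjecture `P₁`. -/
def P1 : Prop := ∀ z : W, ((aFun L z : Γ) : WithTop Γ) ≤ Delta L z

/-- Lusztig's conjecture `P₄`. -/
def P4 : Prop := ∀ z z' : W, leLR L z' z → aFun L z ≤ aFun L z'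

/-- Lusztig's conjecture `P₈`. -/
def P8 : Prop := ∀ x y z : W, gammaCoeff L x y z ≠ 0 →
  simL L x y⁻¹ ∧ simL L y z⁻¹ ∧ simL L z x⁻¹

/-- The coefficients `λ^{(n)}_{x,y}` of `T_{w₀} ^ n C_y = ∑_x λ^{(n)}_{x,y} C_x`, `n ∈ ℤ`. -/
noncomputable def lam (w₀ : W) (n : ℤ) (x y : W) : Coeff Γ :=
  (C L).repr (((TUnit L w₀ ^ n : (Hecke L)ˣ) : Hecke L) * C L y) x

end

end Hecke

end HeckeKL

/-! The case n = 1 carries the theorem. Up to sign, the coefficient of C_u in T_{w₀} is p*_{1,u⁻¹w₀}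
(`repr_C_T_longest`), so P₁ bounds its degree by -a(u⁻¹w₀). When h_{u,y,x} ≠ 0, P₄ and the fact that
w₀ reverses ≤_L (`leL_longest_mul`) bound this in turn by -a(w₀x). Summing these coefficients times
h_{u,y,x} over u gives λ^{(1)}_{x,y}, of degree at most a(x) - a(w₀x); equality needs some
γ_{u,y,x⁻¹} ≠ 0, and then P₈ forces x ∼_L y (`deg_lam_one`). Since a(x) - a(w₀x) can only grow as x
goes down in ≤_L, induction gives all n ≥ 0 (`deg_lam_natCast`).

The coefficients of T_{w₀} and the reversal of ≤_L both come from a duality: for the form (h, h') ↦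
coefficient of T_{w₀} in hh', the basis dual to C_x consists, up to sign, of semilinear twists of
the C_{x⁻¹w₀} (`repr_C_mul_signBar_C`). Its consequence `repr_mul_C_duality` exchanges the matrix
entry (x, y) of one left multiplication with the entry (w₀y, w₀x) of another. Applied to T_{w₀}^n it
turns the bound for n into the bound for -n (`deg_lam_neg`).

For even n and x ∼_L y, the functions z ↦ a(z) and z ↦ a(w₀z) agree on x and y. As λ^{(-n)} is the
bar conjugate of λ^{(n)}, the two bounds squeeze λ^{(n)}_{x,y} into a single monomial. Its integer
coefficient is read off at v = 1, where T_{w₀}² becomes w₀² = 1. -/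

namespace HeckeKL

/-! ### Inversions and the longest element -/

section Longest

variable {B W : Type*} [Group W] {M : CoxeterMatrix B} (cs : CoxeterSystem M W)

/-- The action of `W` on `W × ℤ/2` extending `parityStep`. -/
noncomputable def parityHom : W →* Function.End (W × ZMod 2) :=
  cs.lift ⟨parityStep cs, parityStep_isLiftable cs⟩

/-- The parity of the number of occurrences of `t` in the inversion sequence of a word for `w`. -/
noncomputable def inversionParity (w t : W) : ZMod 2 := (parityHom cs w (t, 0)).2

open Classical in
theorem parityHom_wordProd (ω : List B) (p : W × ZMod 2) :
    parityHom cs (cs.wordProd ω) p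
      = (cs.wordProd ω * p.1 * (cs.wordProd ω)⁻¹,
          p.2 + ((cs.rightInvSeq ω).count p.1 : ZMod 2)) := by
  have h : ω.map (parityHom cs ∘ cs.simple) = ω.map (parityStep cs) :=
    List.map_congr_left fun i _ => cs.lift_apply_simple _ i
  rw [← parityStep_word, CoxeterSystem.wordProd, map_list_prod, List.map_map, h]

open Classical in
theorem inversionParity_wordProd (ω : List B) (t : W) :
    inversionParity cs (cs.wordProd ω) t = ((cs.rightInvSeq ω).count t : ZMod 2) := by
  rw [inversionParity, parityHom_wordProd, zero_add]

theorem parityHom_apply (w : W) (p : W × ZMod 2) :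
    parityHom cs w p = (w * p.1 * w⁻¹, p.2 + inversionParity cs w p.1) := by
  obtain ⟨ω, _, rfl⟩ := cs.exists_isReduced w
  rw [parityHom_wordProd, inversionParity_wordProd]

/-- This cocycle rule is the homomorphism property of `parityHom`, read in the second component. -/
theorem inversionParity_mul (u w t : W) :
    inversionParity cs (u * w) t = inversionParity cs w t + inversionParity cs u (w * t * w⁻¹) := by
  rw [inversionParity, map_mul, end_mul_apply, parityHom_apply, parityHom_apply]
  simp

theorem inversionParity_simple (i : B) : inversionParity cs (cs.simple i) (cs.simple i) = 1 := by
  have := inversionParity_wordProd cs [i] (cs.simple i)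
  simpa using this

theorem inversionParity_one (t : W) : inversionParity cs 1 t = 0 := by
  have := inversionParity_wordProd cs [] t
  simpa using this

theorem inversionParity_self {t : W} (ht : cs.IsReflection t) : inversionParity cs t t = 1 := by
  obtain ⟨u, i, rfl⟩ := ht
  -- Expanding the cocycle for 1 = u u⁻¹ shows that the contributions of u and u⁻¹ to the parity of
  -- t = u s u⁻¹ cancel; only that of s remains.
  have h := inversionParity_mul cs u u⁻¹ (u * cs.simple i * u⁻¹)
  rw [mul_inv_cancel, inversionParity_one] at h
  rw [inversionParity_mul, inversionParity_mul]
  have e : u⁻¹ * (u * cs.simple i * u⁻¹) * u⁻¹⁻¹ = cs.simple i := by group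
  rw [e] at h ⊢
  rw [mul_inv_cancel_right, inversionParity_simple, add_left_comm, ← h, add_zero]

theorem mem_rightInvSeq_iff {ω : List B} (hω : cs.IsReduced ω) (t : W) :
    t ∈ cs.rightInvSeq ω ↔ inversionParity cs (cs.wordProd ω) t = 1 := by
  classical
  rw [inversionParity_wordProd]
  by_cases h : t ∈ cs.rightInvSeq ω
  · simp [h, List.count_eq_one_of_mem hω.nodup_rightInvSeq h]
  · simp [h, List.count_eq_zero.2 h]

theorem isRightInversion_of_inversionParity {w t : W} (h : inversionParity cs w t = 1) :
    cs.IsRightInversion w t := by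
  obtain ⟨ω, hω, rfl⟩ := cs.exists_isReduced w
  exact cs.isRightInversion_of_mem_rightInvSeq hω ((mem_rightInvSeq_iff cs hω t).2 h)

theorem zmod_two_cases (a : ZMod 2) : a = 0 ∨ a = 1 := by
  revert a
  decide

/-- The inversion sequence of a reduced word has no repetitions, so parity is multiplicity there.
Length thus becomes a count to which the cocycle rule applies. -/
theorem length_eq_card [Fintype W] (w : W) :
    cs.length w = (Finset.univ.filter fun t => inversionParity cs w t = 1).card := by
  classical
  obtain ⟨ω, hω, rfl⟩ := cs.exists_isReduced w
  have h : (Finset.univ.filter fun t => inversionParity cs (cs.wordProd ω) t = 1)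
      = (cs.rightInvSeq ω).toFinset := by
    ext t
    simp [mem_rightInvSeq_iff cs hω]
  rw [h, List.toFinset_card_of_nodup hω.nodup_rightInvSeq, cs.length_rightInvSeq]
  exact hω

variable {w₀ : W} (hw₀ : ∀ w : W, cs.length w ≤ cs.length w₀)
include hw₀

/-- Otherwise t would be an inversion of w₀t, making w₀t longer than w₀. -/
theorem inversionParity_longest {t : W} (ht : cs.IsReflection t) : inversionParity cs w₀ t = 1 := by
  rcases zmod_two_cases (inversionParity cs w₀ t) with h | h
  · have h1 : inversionParity cs (w₀ * t) t = 1 := by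
      rw [inversionParity_mul, inversionParity_self cs ht, mul_inv_cancel_right, h, add_zero]
    have h2 := (isRightInversion_of_inversionParity cs h1).2
    rw [mul_assoc, ht.mul_self, mul_one] at h2
    exact absurd (hw₀ (w₀ * t)) (not_le.2 h2)
  · exact h

variable [Fintype W]

/-- By the cocycle rule for w₀ = (w₀w⁻¹)w, each reflection t satisfies exactly one of: t is an
inversion of w, or wtw⁻¹ is an inversion of w₀w⁻¹. Conjugation by w does not change the second
count. -/
theorem length_longest_mul_inv (w : W) :
    cs.length (w₀ * w⁻¹) + cs.length w = cs.length w₀ := by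
  classical
  have hr : ∀ t, inversionParity cs w₀ t =
      inversionParity cs w t + inversionParity cs (w₀ * w⁻¹) (w * t * w⁻¹) := fun t => by
    rw [← inversionParity_mul, inv_mul_cancel_right]
  have hc : (Finset.univ.filter fun t => inversionParity cs (w₀ * w⁻¹) t = 1).card =
      (Finset.univ.filter fun t => inversionParity cs (w₀ * w⁻¹) (w * t * w⁻¹) = 1).card := by
    symm
    apply Finset.card_bij (fun t _ => w * t * w⁻¹)
    · intro t ht
      simpa using ht
    · intro t _ t' _ h
      simpa using h
    · intro t ht
      refine ⟨w⁻¹ * t * w, ?_, by group⟩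
      have e : w * (w⁻¹ * t * w) * w⁻¹ = t := by group
      simpa [e] using ht
  rw [length_eq_card cs (w₀ * w⁻¹), length_eq_card cs w, length_eq_card cs w₀, hc,
    ← Finset.card_union_of_disjoint]
  · congr 1
    ext t
    simp only [Finset.mem_union, Finset.mem_filter, Finset.mem_univ, true_and]
    constructor
    · intro h
      apply inversionParity_longest cs hw₀
      rcases h with h | h
      · have := (isRightInversion_of_inversionParity cs h).1
        rwa [cs.isReflection_conj_iff] at this
      · exact (isRightInversion_of_inversionParity cs h).1
    · intro h
      rw [hr] at h
      rcases zmod_two_cases (inversionParity cs w t) with h1 | h1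
      · left
        rwa [h1, zero_add] at h
      · exact Or.inr h1
  · rw [Finset.disjoint_left]
    intro t h1 h2
    simp only [Finset.mem_filter, Finset.mem_univ, true_and] at h1 h2
    have h3 := inversionParity_longest cs hw₀ (isRightInversion_of_inversionParity cs h2).1
    rw [hr, h1, h2] at h3
    exact absurd h3 (by decide)

theorem longest_mul_self : w₀ * w₀ = 1 := by
  have := length_longest_mul_inv cs hw₀ w₀⁻¹
  rw [inv_inv, cs.length_inv] at this
  exact cs.length_eq_zero_iff.1 (by omega)

theorem longest_inv : w₀⁻¹ = w₀ := inv_eq_of_mul_eq_one_left (longest_mul_self cs hw₀)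

theorem longest_mul_longest_mul (w : W) : w₀ * (w₀ * w) = w := by
  rw [← mul_assoc, longest_mul_self cs hw₀, one_mul]

theorem longest_conj_conj (w : W) : w₀ * (w₀ * w * w₀) * w₀ = w := by
  rw [mul_assoc w₀ w w₀, longest_mul_longest_mul cs hw₀, mul_assoc, longest_mul_self cs hw₀,
    mul_one]

theorem length_longest_mul (w : W) : cs.length (w₀ * w) + cs.length w = cs.length w₀ := by
  have := length_longest_mul_inv cs hw₀ w⁻¹
  rwa [inv_inv, cs.length_inv] at this

theorem length_mul_longest (w : W) : cs.length (w * w₀) + cs.length w = cs.length w₀ := by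
  have := length_longest_mul_inv cs hw₀ w
  rwa [← cs.length_inv (w₀ * w⁻¹), mul_inv_rev, inv_inv, longest_inv cs hw₀] at this

theorem length_longest_conj (w : W) : cs.length (w₀ * w * w₀) = cs.length w := by
  have h1 := length_longest_mul cs hw₀ w
  have h2 := length_mul_longest cs hw₀ (w₀ * w)
  omega

theorem exists_longest_conj_simple (i : B) : ∃ j : B, w₀ * cs.simple i * w₀ = cs.simple j := by
  have h := length_longest_conj cs hw₀ (cs.simple i)
  rw [cs.length_simple] at h
  obtain ⟨j, hj⟩ := cs.length_eq_one_iff.1 h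
  exact ⟨j, hj⟩

end Longest

/-! ### Degrees in the group ring of Γ -/

section Degree

variable {Γ : Type*} [AddCommGroup Γ] [LinearOrder Γ]

theorem deg_le_iff {a : Coeff Γ} {γ : Γ} :
    deg a ≤ (γ : WithBot Γ) ↔ ∀ δ, γ < δ → a.coeff δ = 0 := by
  unfold deg
  rw [Finset.max, Finset.sup_le_iff]
  constructor
  · intro h δ hδ
    by_contra hne
    exact absurd (WithBot.coe_le_coe.1 (h δ (Finsupp.mem_support_iff.2 hne))) (not_le.2 hδ)
  · intro h δ hδ
    refine WithBot.coe_le_coe.2 (le_of_not_gt fun hlt => ?_)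
    exact Finsupp.mem_support_iff.1 hδ (h δ hlt)

theorem deg_lt_iff {a : Coeff Γ} {γ : Γ} :
    deg a < (γ : WithBot Γ) ↔ ∀ δ, γ ≤ δ → a.coeff δ = 0 := by
  unfold deg
  rw [Finset.max, Finset.sup_lt_iff (WithBot.bot_lt_coe _)]
  constructor
  · intro h δ hδ
    by_contra hne
    exact absurd (WithBot.coe_lt_coe.1 (h δ (Finsupp.mem_support_iff.2 hne))) (not_lt.2 hδ)
  · intro h δ hδ
    refine WithBot.coe_lt_coe.2 (lt_of_not_ge fun hle => ?_)
    exact Finsupp.mem_support_iff.1 hδ (h δ hle)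

/-- Applied to h_{x,y,z} and a(z), it makes the vanishing of an integer γ_{x,y,z⁻¹} into a strict
bound. -/
theorem deg_lt_of_coeff_eq_zero {a : Coeff Γ} {γ : Γ} (h : deg a ≤ (γ : WithBot Γ))
    (h0 : a.coeff γ = 0) : deg a < (γ : WithBot Γ) := by
  rw [deg_le_iff] at h
  rw [deg_lt_iff]
  intro δ hδ
  rcases hδ.eq_or_lt with rfl | hlt
  · exact h0
  · exact h δ hlt

theorem deg_zero : deg (0 : Coeff Γ) = ⊥ := by
  simp [deg]

theorem deg_neg (a : Coeff Γ) : deg (-a) = deg a := by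
  simp [deg]

theorem deg_neg_one_pow_mul (k : ℕ) (a : Coeff Γ) : deg ((-1) ^ k * a) = deg a := by
  rcases neg_one_pow_eq_or (Coeff Γ) k with h | h
  · rw [h, one_mul]
  · rw [h, neg_one_mul, deg_neg]

theorem deg_v (γ : Γ) : deg (v γ) = γ := by
  apply le_antisymm
  · rw [deg_le_iff]
    intro δ hδ
    simp [v, hδ.ne]
  · rw [← not_lt, deg_lt_iff]
    intro h
    have := h γ le_rfl
    simp [v] at this

theorem deg_sum_le {ι : Type*} {s : Finset ι} {f : ι → Coeff Γ} {γ : Γ}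
    (h : ∀ i ∈ s, deg (f i) ≤ (γ : WithBot Γ)) : deg (∑ i ∈ s, f i) ≤ (γ : WithBot Γ) := by
  simp only [deg_le_iff] at *
  intro δ hδ
  rw [AddMonoidAlgebra.coeff_sum, Finsupp.finsetSum_apply]
  exact Finset.sum_eq_zero fun i hi => h i hi δ hδ

theorem deg_sum_lt {ι : Type*} {s : Finset ι} {f : ι → Coeff Γ} {γ : Γ}
    (h : ∀ i ∈ s, deg (f i) < (γ : WithBot Γ)) : deg (∑ i ∈ s, f i) < (γ : WithBot Γ) := by
  simp only [deg_lt_iff] at *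
  intro δ hδ
  rw [AddMonoidAlgebra.coeff_sum, Finsupp.finsetSum_apply]
  exact Finset.sum_eq_zero fun i hi => h i hi δ hδ

theorem exists_coeff_of_coeff_mul {a b : Coeff Γ} {δ : Γ} (h : (a * b).coeff δ ≠ 0) :
    ∃ α β, α + β = δ ∧ a.coeff α ≠ 0 ∧ b.coeff β ≠ 0 := by
  classical
  have := AddMonoidAlgebra.support_coeff_mul_subset a b (Finsupp.mem_support_iff.2 h)
  obtain ⟨α, hα, β, hβ, rfl⟩ := Finset.mem_add.1 this
  exact ⟨α, β, rfl, Finsupp.mem_support_iff.1 hα, Finsupp.mem_support_iff.1 hβ⟩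

theorem le_of_coeff_ne_zero {a : Coeff Γ} {γ δ : Γ} (h : deg a ≤ (γ : WithBot Γ))
    (hδ : a.coeff δ ≠ 0) : δ ≤ γ :=
  le_of_not_gt fun hlt => hδ (deg_le_iff.1 h δ hlt)

theorem lt_of_coeff_ne_zero {a : Coeff Γ} {γ δ : Γ} (h : deg a < (γ : WithBot Γ))
    (hδ : a.coeff δ ≠ 0) : δ < γ :=
  lt_of_not_ge fun hlt => hδ (deg_lt_iff.1 h δ hlt)

variable [IsOrderedAddMonoid Γ]

theorem deg_mul_le {a b : Coeff Γ} {α β : Γ} (ha : deg a ≤ (α : WithBot Γ))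
    (hb : deg b ≤ (β : WithBot Γ)) : deg (a * b) ≤ ((α + β : Γ) : WithBot Γ) := by
  rw [deg_le_iff]
  intro δ hδ
  by_contra hne
  obtain ⟨x, y, rfl, hx, hy⟩ := exists_coeff_of_coeff_mul hne
  exact absurd (add_le_add (le_of_coeff_ne_zero ha hx) (le_of_coeff_ne_zero hb hy)) (not_le.2 hδ)

theorem deg_mul_lt_of_le_of_lt {a b : Coeff Γ} {α β : Γ} (ha : deg a ≤ (α : WithBot Γ))
    (hb : deg b < (β : WithBot Γ)) : deg (a * b) < ((α + β : Γ) : WithBot Γ) := by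
  rw [deg_lt_iff]
  intro δ hδ
  by_contra hne
  obtain ⟨x, y, rfl, hx, hy⟩ := exists_coeff_of_coeff_mul hne
  exact absurd (add_lt_add_of_le_of_lt (le_of_coeff_ne_zero ha hx) (lt_of_coeff_ne_zero hb hy))
    (not_lt.2 hδ)

theorem deg_mul_lt_of_lt_of_le {a b : Coeff Γ} {α β : Γ} (ha : deg a < (α : WithBot Γ))
    (hb : deg b ≤ (β : WithBot Γ)) : deg (a * b) < ((α + β : Γ) : WithBot Γ) := by
  rw [mul_comm, add_comm]
  exact deg_mul_lt_of_le_of_lt hb ha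

theorem deg_v_neg_lt_zero {γ : Γ} (h : 0 < γ) : deg (v (-γ)) < 0 := by
  rw [deg_v]
  exact WithBot.coe_lt_coe.2 (neg_neg_of_pos h)

end Degree

/-! ### Specialization at v = 1 -/

section Augmentation

variable {Γ : Type*} [AddCommGroup Γ]

variable (Γ) in
/-- The specialization `v ^ γ ↦ 1`. -/
noncomputable def augmentation : Coeff Γ →+* ℤ :=
  (AddMonoidAlgebra.lift ℤ ℤ Γ (1 : Multiplicative Γ →* ℤ)).toRingHom

theorem augmentation_single (γ : Γ) (m : ℤ) :
    augmentation Γ (AddMonoidAlgebra.single γ m) = m := by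
  simp [augmentation]

theorem augmentation_v (γ : Γ) : augmentation Γ (v γ) = 1 := augmentation_single γ 1

end Augmentation

end HeckeKL

namespace HeckeKL

/-! ### Involutions of the Hecke algebra and its trace form -/

section Involutions

variable {B W : Type*} [Group W] {M : CoxeterMatrix B} {cs : CoxeterSystem M W}
  {Γ : Type*} [AddCommGroup Γ] [LinearOrder Γ] (L : WeightFunction cs Γ)

/-- Reduces multiplicativity of a map to its behaviour under left multiplication by generators. -/
theorem gen_induction {p : Hecke L → Prop} (h1 : p 1) (hg : ∀ i h, p h → p (gen L i * h))
    (hadd : ∀ x y, p x → p y → p (x + y)) (hsmul : ∀ (a : Coeff Γ) x, p x → p (a • x))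
    (h : Hecke L) : p h := by
  induction h using hecke_induction with
  | h0 => simpa using hsmul 0 1 h1
  | hadd x y hx hy => exact hadd x y hx hy
  | hsmul a x hx => exact hsmul a x hx
  | hT w =>
    induction w using length_induction cs with
    | one => rwa [T_one]
    | step i u hu ih =>
      rw [← gen_mul_T_up L hu]
      exact hg i _ ih

theorem bar_one : bar L 1 = 1 := by
  have := bar_T_one L
  rwa [T_one] at this

theorem bar_gen (i : B) : bar L (gen L i) = gen L i - param L i • 1 := by
  have := bar_gen_mul L i 1
  rwa [bar_one, mul_one, mul_one] at this

theorem bar_mul (h h' : Hecke L) : bar L (h * h') = bar L h * bar L h' := by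
  induction h using gen_induction with
  | h1 => rw [one_mul, bar_one, one_mul]
  | hg i h ih => rw [mul_assoc, bar_gen_mul, ih, bar_gen_mul, mul_assoc]
  | hadd x y hx hy => rw [add_mul, bar_add, hx, hy, bar_add, add_mul]
  | hsmul a x hx => rw [smul_mul_assoc, bar_smul, hx, bar_smul, smul_mul_assoc]

theorem bar_pow (h : Hecke L) (n : ℕ) : bar L (h ^ n) = bar L h ^ n := by
  induction n with
  | zero => rw [pow_zero, pow_zero, bar_one]
  | succ n ih => rw [pow_succ, bar_mul, ih, pow_succ]

/-- The semilinear involution `a T_w ↦ (-1) ^ ℓ(w) (bar a) T_w`. -/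
noncomputable def signBar (h : Hecke L) : Hecke L :=
  ((T L).repr h).sum fun w a => barA a • ((-1) ^ cs.length w : Coeff Γ) • T L w

theorem signBar_add (h h' : Hecke L) : signBar L (h + h') = signBar L h + signBar L h' := by
  unfold signBar
  rw [map_add, Finsupp.sum_add_index']
  · intro w
    rw [map_zero, zero_smul]
  · intro w a b
    rw [map_add, add_smul]

theorem signBar_smul (a : Coeff Γ) (h : Hecke L) : signBar L (a • h) = barA a • signBar L h := by
  unfold signBar
  rw [map_smul, Finsupp.sum_smul_index', Finsupp.smul_sum]
  · simp only [smul_eq_mul, map_mul, mul_smul]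
  · intro w
    rw [map_zero, zero_smul]

theorem signBar_T (w : W) : signBar L (T L w) = ((-1) ^ cs.length w : Coeff Γ) • T L w := by
  unfold signBar
  rw [Module.Basis.repr_self, Finsupp.sum_single_index]
  · rw [map_one, one_smul]
  · rw [map_zero, zero_smul]

theorem barA_neg_one_pow (k : ℕ) : barA ((-1) ^ k : Coeff Γ) = (-1) ^ k := by
  rw [map_pow, map_neg, map_one]

theorem signBar_zero : signBar L 0 = 0 := by
  have := signBar_smul L 0 0
  rwa [map_zero, zero_smul, zero_smul] at this

theorem signBar_neg (h : Hecke L) : signBar L (-h) = -signBar L h := by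
  rw [eq_neg_iff_add_eq_zero, ← signBar_add, neg_add_cancel, signBar_zero]

theorem signBar_sub (h h' : Hecke L) : signBar L (h - h') = signBar L h - signBar L h' := by
  rw [sub_eq_add_neg, signBar_add, signBar_neg, ← sub_eq_add_neg]

theorem signBar_one : signBar L 1 = 1 := by
  have := signBar_T L 1
  simpa [T_one] using this

/-- Semilinearity is what makes the sign twist multiplicative: T_s ↦ -T_s respects the quadratic
relation because conjugation also negates its parameter. -/
theorem signBar_gen_mul (i : B) (h : Hecke L) :
    signBar L (gen L i * h) = -(gen L i * signBar L h) := by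
  induction h using hecke_induction with
  | h0 => rw [mul_zero, signBar_zero, mul_zero, neg_zero]
  | hadd x y hx hy => rw [mul_add, signBar_add, hx, hy, signBar_add, mul_add, neg_add]
  | hsmul a x hx => rw [mul_smul_comm, signBar_smul, hx, signBar_smul, mul_smul_comm, smul_neg]
  | hT w =>
    have hs : ((-1) ^ cs.length (cs.simple i * w) : Coeff Γ) = -(-1) ^ cs.length w := by
      rcases cs.length_simple_mul w i with hl | hl
      · rw [hl, pow_succ, mul_neg_one]
      · rw [← hl, pow_succ, mul_neg_one, neg_neg]
    rw [signBar_T, mul_smul_comm, gen_mul_T, signBar_add, signBar_T, hs]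
    split_ifs
    · rw [signBar_smul, signBar_T, barA_param]
      module
    · rw [signBar_zero]
      module

theorem signBar_mul (h h' : Hecke L) : signBar L (h * h') = signBar L h * signBar L h' := by
  induction h using gen_induction with
  | h1 => rw [one_mul, signBar_one, one_mul]
  | hg i h ih =>
    rw [mul_assoc, signBar_gen_mul, ih, signBar_gen_mul, ← mul_assoc]
    exact (neg_mul (gen L i * signBar L h) (signBar L h')).symm
  | hadd x y hx hy => rw [add_mul, signBar_add, hx, hy, signBar_add, add_mul]
  | hsmul a x hx => rw [smul_mul_assoc, signBar_smul, hx, signBar_smul, smul_mul_assoc]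

theorem signBar_pow (h : Hecke L) (n : ℕ) : signBar L (h ^ n) = signBar L h ^ n := by
  induction n with
  | zero => rw [pow_zero, pow_zero, signBar_one]
  | succ n ih => rw [pow_succ, signBar_mul, ih, pow_succ]

theorem signBar_gen (i : B) : signBar L (gen L i) = -gen L i := by
  have := signBar_gen_mul L i 1
  rwa [signBar_one, mul_one] at this

theorem signBar_signBar (h : Hecke L) : signBar L (signBar L h) = h := by
  induction h using hecke_induction with
  | h0 => rw [signBar_zero, signBar_zero]
  | hadd x y hx hy => rw [signBar_add, signBar_add, hx, hy]
  | hsmul a x hx => rw [signBar_smul, signBar_smul, hx, barA_barA]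
  | hT w =>
    rw [signBar_T, signBar_smul, signBar_T, barA_neg_one_pow, smul_smul, ← mul_pow]
    simp

theorem bar_signBar (h : Hecke L) : bar L (signBar L h) = signBar L (bar L h) := by
  induction h using gen_induction with
  | h1 => rw [signBar_one, bar_one, signBar_one]
  | hg i h ih =>
    rw [signBar_gen_mul, bar_neg, bar_gen_mul, ih, bar_gen_mul, signBar_mul, signBar_sub,
      signBar_gen, signBar_smul, signBar_one, barA_param]
    refine (neg_mul (gen L i - param L i • 1) (signBar L (bar L h))).symm.trans ?_
    congr 1
    module
  | hadd x y hx hy => rw [signBar_add, bar_add, hx, hy, bar_add, signBar_add]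
  | hsmul a x hx => rw [signBar_smul, bar_smul, hx, bar_smul, signBar_smul]

theorem repr_signBar (h : Hecke L) (y : W) :
    (T L).repr (signBar L h) y = (-1) ^ cs.length y * barA ((T L).repr h y) := by
  classical
  induction h using hecke_induction with
  | h0 => simp [signBar_zero]
  | hadd x y hx hy => rw [signBar_add, map_add, Finsupp.add_apply, hx, hy, map_add,
      Finsupp.add_apply, map_add, mul_add]
  | hsmul a x hx =>
    rw [signBar_smul, map_smul, Finsupp.smul_apply, hx, map_smul, Finsupp.smul_apply, smul_eq_mul,
      smul_eq_mul, map_mul, mul_left_comm]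
  | hT w =>
    rw [signBar_T, map_smul, Finsupp.smul_apply, Module.Basis.repr_self, Finsupp.single_apply,
      smul_eq_mul]
    split_ifs with h
    · rw [h, map_one]
    · rw [map_zero, mul_zero, mul_zero]

theorem T_mul_gen_eq (i : B) (w : W) : T L w * gen L i = T L (w * cs.simple i) +
    if cs.length (w * cs.simple i) < cs.length w then param L i • T L w else 0 := by
  have hup : ∀ u : W, cs.length (u * cs.simple i) = cs.length u + 1 →
      T L u * gen L i = T L (u * cs.simple i) := fun u hu => by
    rw [← T_simple, T_mul_T L _ _ (by rw [hu, cs.length_simple])]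
  rcases cs.length_mul_simple w i with hl | hl
  · rw [hup w hl, if_neg (by omega), add_zero]
  · have h1 := hup (w * cs.simple i) (by rw [CoxeterSystem.simple_mul_simple_cancel_right, hl])
    rw [CoxeterSystem.simple_mul_simple_cancel_right] at h1
    have h2 := T_simple_sq L i
    rw [T_simple, sq] at h2
    rw [if_pos (by omega)]
    nth_rw 1 [← h1]
    rw [mul_assoc, h2, mul_add, mul_one, mul_smul_comm, h1]

/-- The linear anti-involution `T_w ↦ T_{w⁻¹}`. -/
noncomputable def flat : Hecke L →ₗ[Coeff Γ] Hecke L :=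
  (T L).constr (Coeff Γ) fun w => T L w⁻¹

theorem flat_T (w : W) : flat L (T L w) = T L w⁻¹ := by
  rw [flat, Module.Basis.constr_basis]

theorem flat_one : flat L 1 = 1 := by
  rw [← T_one, flat_T, inv_one]

theorem flat_gen (i : B) : flat L (gen L i) = gen L i := by
  rw [← T_simple, flat_T, cs.inv_simple]

theorem flat_gen_mul (i : B) (h : Hecke L) : flat L (gen L i * h) = flat L h * gen L i := by
  induction h using hecke_induction with
  | h0 => rw [mul_zero, map_zero, zero_mul]
  | hadd x y hx hy => rw [mul_add, map_add, hx, hy, map_add, add_mul]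
  | hsmul a x hx => rw [mul_smul_comm, map_smul, hx, map_smul, smul_mul_assoc]
  | hT w =>
    have e : w⁻¹ * cs.simple i = (cs.simple i * w)⁻¹ := by simp
    rw [gen_mul_T, map_add, flat_T, flat_T, T_mul_gen_eq, e, cs.length_inv, cs.length_inv]
    split_ifs
    · rw [map_smul, flat_T]
    · rw [map_zero]

theorem flat_mul (h h' : Hecke L) : flat L (h * h') = flat L h' * flat L h := by
  induction h using gen_induction with
  | h1 => rw [one_mul, flat_one, mul_one]
  | hg i h ih => rw [mul_assoc, flat_gen_mul, ih, flat_gen_mul, mul_assoc]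
  | hadd x y hx hy => rw [add_mul, map_add, hx, hy, map_add, mul_add]
  | hsmul a x hx => rw [smul_mul_assoc, map_smul, hx, map_smul, mul_smul_comm]

theorem flat_pow (h : Hecke L) (n : ℕ) : flat L (h ^ n) = flat L h ^ n := by
  induction n with
  | zero => rw [pow_zero, pow_zero, flat_one]
  | succ n ih => rw [pow_succ, flat_mul, ih, pow_succ']

theorem repr_flat (h : Hecke L) (y : W) : (T L).repr (flat L h) y = (T L).repr h y⁻¹ := by
  classical
  induction h using hecke_induction with
  | h0 => simp
  | hadd x y hx hy => rw [map_add, map_add, Finsupp.add_apply, hx, hy, map_add, Finsupp.add_apply]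
  | hsmul a x hx => rw [map_smul, map_smul, Finsupp.smul_apply, hx, map_smul, Finsupp.smul_apply]
  | hT w =>
    rw [flat_T, Module.Basis.repr_self, Module.Basis.repr_self, Finsupp.single_apply,
      Finsupp.single_apply]
    simp only [inv_eq_iff_eq_inv]

theorem bar_flat (h : Hecke L) : bar L (flat L h) = flat L (bar L h) := by
  induction h using gen_induction with
  | h1 => rw [flat_one, bar_one, flat_one]
  | hg i h ih =>
    rw [flat_gen_mul, bar_mul, ih, bar_gen_mul, flat_mul, bar_gen, map_sub, flat_gen, map_smul,
      flat_one]
  | hadd x y hx hy => rw [map_add, bar_add, hx, hy, bar_add, map_add]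
  | hsmul a x hx => rw [map_smul, bar_smul, hx, bar_smul, map_smul]

theorem signBar_flat (h : Hecke L) : signBar L (flat L h) = flat L (signBar L h) := by
  apply (T L).ext_elem
  intro y
  rw [repr_signBar, repr_flat, repr_flat, repr_signBar, cs.length_inv]

/-- Generators are moved from the left factor to the right one. The correction term created when sb
< b could contribute only if u = b, which su > u excludes. -/
theorem repr_T_inv_mul_T_one [DecidableEq W] (a b : W) :
    (T L).repr (T L a⁻¹ * T L b) 1 = if a = b then 1 else 0 := by
  induction a using length_induction cs generalizing b with
  | one =>
    rw [inv_one, T_one, one_mul, Module.Basis.repr_self, Finsupp.single_apply]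
    simp only [eq_comm]
  | step i u hu ih =>
    rw [← T_mul_gen L hu, mul_assoc, gen_mul_T, mul_add, map_add, Finsupp.add_apply, ih]
    have e : u = cs.simple i * b ↔ cs.simple i * u = b := by
      constructor
      · rintro rfl; simp
      · rintro rfl; simp
    simp only [e]
    split_ifs with h1 h2
    · subst h1
      rw [mul_smul_comm, map_smul, Finsupp.smul_apply, ih, if_neg, smul_zero, add_zero]
      intro h
      rw [← h] at hu
      omega
    · rw [mul_zero, map_zero, Finsupp.zero_apply, add_zero]
    · rw [mul_smul_comm, map_smul, Finsupp.smul_apply, ih, if_neg, smul_zero, add_zero]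
      rintro rfl
      omega
    · rw [mul_zero, map_zero, Finsupp.zero_apply, add_zero]

theorem repr_T_mul_T_one [DecidableEq W] (a b : W) :
    (T L).repr (T L a * T L b) 1 = if a * b = 1 then 1 else 0 := by
  have := repr_T_inv_mul_T_one L a⁻¹ b
  rw [inv_inv] at this
  simp only [this, inv_eq_iff_mul_eq_one]

/-- The coefficient of T_1 is a trace, since ab = 1 exactly when ba = 1. -/
theorem repr_mul_comm_one (h h' : Hecke L) :
    (T L).repr (h * h') 1 = (T L).repr (h' * h) 1 := by
  classical
  induction h using hecke_induction with
  | h0 => rw [zero_mul, mul_zero]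
  | hadd x y hx hy => rw [add_mul, mul_add, map_add, map_add, Finsupp.add_apply, hx, hy,
      Finsupp.add_apply]
  | hsmul a x hx => rw [smul_mul_assoc, mul_smul_comm, map_smul, map_smul, Finsupp.smul_apply, hx,
      Finsupp.smul_apply]
  | hT w =>
    induction h' using hecke_induction with
    | h0 => rw [zero_mul, mul_zero]
    | hadd x y hx hy => rw [add_mul, mul_add, map_add, map_add, Finsupp.add_apply, hx, hy,
        Finsupp.add_apply]
    | hsmul a x hx => rw [smul_mul_assoc, mul_smul_comm, map_smul, map_smul, Finsupp.smul_apply,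
        hx, Finsupp.smul_apply]
    | hT u =>
      rw [repr_T_mul_T_one, repr_T_mul_T_one]
      simp only [mul_eq_one_comm (a := w)]

end Involutions

/-! ### Multiplication by T_{w₀} in the standard basis -/

section Longest

variable {B W : Type*} [Group W] [Fintype W] {M : CoxeterMatrix B} {cs : CoxeterSystem M W}
  {Γ : Type*} [AddCommGroup Γ] [LinearOrder Γ] (L : WeightFunction cs Γ)
  {w₀ : W} (hw₀ : ∀ w : W, cs.length w ≤ cs.length w₀)
include hw₀

/-- Bar is unitriangular with respect to length, and w₀ has maximal length. -/
theorem repr_bar_longest (h : Hecke L) :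
    (T L).repr (bar L h) w₀ = barA ((T L).repr h w₀) :=
  repr_bar_top L (n := cs.length w₀) ((mem_low L).2 fun y hy => by
    have := hw₀ y
    omega) rfl

theorem repr_mul_T_longest (h : Hecke L) : (T L).repr (h * T L w₀) 1 = (T L).repr h w₀ := by
  classical
  induction h using hecke_induction with
  | h0 => simp
  | hadd x y hx hy => rw [add_mul, map_add, map_add, Finsupp.add_apply, hx, hy, Finsupp.add_apply]
  | hsmul a x hx => rw [smul_mul_assoc, map_smul, map_smul, Finsupp.smul_apply, hx,
      Finsupp.smul_apply]
  | hT w =>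
    rw [repr_T_mul_T_one, Module.Basis.repr_self, Finsupp.single_apply]
    simp only [mul_eq_one_iff_eq_inv, longest_inv cs hw₀]

/-- T_{w₀} has two length-additive factorizations, T_{w₀y⁻¹}T_y and T_{w₀yw₀}T_{w₀y⁻¹}; insert the
second on the left and regroup by the first. -/
theorem T_longest_mul_T (y : W) : T L w₀ * T L y = T L (w₀ * y * w₀) * T L w₀ := by
  have h1 := length_longest_mul_inv cs hw₀ y
  have h2 := length_longest_conj cs hw₀ y
  have e1 : w₀ * y⁻¹ * y = w₀ := by group
  have e2 : w₀ * y * w₀ * (w₀ * y⁻¹) = w₀ := by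
    rw [mul_assoc, longest_mul_longest_mul cs hw₀, mul_inv_cancel_right]
  have h3 := T_mul_T L (w₀ * y⁻¹) y (by rw [e1, h1])
  have h4 := T_mul_T L (w₀ * y * w₀) (w₀ * y⁻¹) (by rw [e2]; omega)
  rw [e1] at h3
  rw [e2] at h4
  conv_lhs => rw [← h4]
  rw [mul_assoc, h3]

theorem bar_T_mul_T_longest (b : W) : bar L (T L b) * T L w₀ = T L (b * w₀) := by
  have e : b⁻¹ * (b * w₀) = w₀ := by group
  have h := T_mul_T L b⁻¹ (b * w₀) (by
    have := length_mul_longest cs hw₀ b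
    rw [e, cs.length_inv]
    omega)
  rw [e] at h
  rw [bar_T, ← h, ← TUnit_val L b⁻¹, Units.inv_mul_cancel_left]

theorem bar_T_longest : bar L (T L w₀) = (((TUnit L w₀)⁻¹ : (Hecke L)ˣ) : Hecke L) := by
  rw [bar_T, longest_inv cs hw₀]

/-- Conjugation by `T_{w₀}` permutes the standard basis. -/
theorem repr_conj_longest (h : Hecke L) (y : W) :
    (T L).repr (T L w₀ * h * bar L (T L w₀)) (w₀ * y * w₀) = (T L).repr h y := by
  classical
  induction h using hecke_induction with
  | h0 => simp
  | hadd x y hx hy => rw [mul_add, add_mul, map_add, map_add, Finsupp.add_apply, hx, hy,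
      Finsupp.add_apply]
  | hsmul a x hx => rw [mul_smul_comm, smul_mul_assoc, map_smul, map_smul, Finsupp.smul_apply, hx,
      Finsupp.smul_apply]
  | hT w =>
    rw [T_longest_mul_T L hw₀, bar_T_longest L hw₀, mul_assoc, ← TUnit_val L w₀, Units.mul_inv,
      mul_one, Module.Basis.repr_self, Module.Basis.repr_self, Finsupp.single_apply,
      Finsupp.single_apply]
    simp

theorem commute_T_longest_sq (h : Hecke L) : Commute (T L w₀ * T L w₀) h := by
  induction h using hecke_induction with
  | h0 => exact Commute.zero_right _
  | hadd x y hx hy => exact hx.add_right hy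
  | hsmul a x hx => exact hx.smul_right a
  | hT w =>
    change T L w₀ * T L w₀ * T L w = T L w * (T L w₀ * T L w₀)
    rw [mul_assoc, T_longest_mul_T L hw₀, ← mul_assoc, T_longest_mul_T L hw₀, mul_assoc (T L _)]
    rw [longest_conj_conj cs hw₀]

end Longest

/-! ### Symmetries of the Kazhdan–Lusztig basis and of the function a -/

section KazhdanLusztig

variable {B W : Type*} [Group W] {M : CoxeterMatrix B} {cs : CoxeterSystem M W}
  {Γ : Type*} [AddCommGroup Γ] [LinearOrder Γ] [IsOrderedAddMonoid Γ] (L : WeightFunction cs Γ)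

theorem eq_C {c : Hecke L} {w : W} (hb : bar L c = c)
    (hd : ∀ y, deg ((T L).repr (c - T L w) y) < 0) : c = C L w := by
  rw [C_apply]
  exact (existsUnique_kl L w).unique ⟨hb, hd⟩ (klElement_spec L w)

theorem bar_C (w : W) : bar L (C L w) = C L w := by
  rw [C_apply]
  exact (klElement_spec L w).1

theorem deg_repr_C_sub (w y : W) : deg ((T L).repr (C L w - T L w) y) < 0 := by
  rw [C_apply]
  exact (klElement_spec L w).2 y

theorem C_simple (i : B) :
    C L (cs.simple i) = gen L i + v (-L.toFun (cs.simple i)) • 1 := by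
  classical
  symm
  apply eq_C
  · rw [bar_add, bar_smul, bar_one, bar_gen, barA_v, neg_neg, param]
    module
  · intro y
    rw [T_simple, add_sub_cancel_left, ← T_one, map_smul, Finsupp.smul_apply,
      Module.Basis.repr_self, Finsupp.single_apply, smul_eq_mul]
    split_ifs
    · rw [mul_one]
      exact deg_v_neg_lt_zero (L.pos i)
    · rw [mul_zero, deg_zero]
      exact WithBot.bot_lt_coe _

theorem flat_C (w : W) : flat L (C L w) = C L w⁻¹ := by
  apply eq_C
  · rw [bar_flat, bar_C]
  · intro y
    rw [← flat_T, ← map_sub, repr_flat]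
    exact deg_repr_C_sub L w _

theorem bar_signBar_C (w : W) : bar L (signBar L (C L w)) = signBar L (C L w) := by
  rw [bar_signBar, bar_C]

theorem repr_C_flat (h : Hecke L) (y : W) : (C L).repr (flat L h) y = (C L).repr h y⁻¹ := by
  classical
  have e : (C L).coord y ∘ₗ flat L = (C L).coord y⁻¹ := by
    apply (C L).ext
    intro w
    simp only [LinearMap.comp_apply, flat_C, Module.Basis.coord_apply, Module.Basis.repr_self,
      Finsupp.single_apply, inv_eq_iff_eq_inv]
  exact LinearMap.congr_fun e h

theorem hCoeff_inv (x y z : W) : hCoeff L x⁻¹ y⁻¹ z⁻¹ = hCoeff L y x z := by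
  rw [hCoeff, ← flat_C, ← flat_C, ← flat_mul, repr_C_flat, inv_inv, hCoeff]

theorem C_induction {p : Hecke L → Prop} (zero : p 0) (basis : ∀ w, p (C L w))
    (add : ∀ x y, p x → p y → p (x + y)) (smul : ∀ (a : Coeff Γ) x, p x → p (a • x))
    (h : Hecke L) : p h := by
  induction (C L).mem_span h using Submodule.span_induction with
  | mem x hx =>
    obtain ⟨w, rfl⟩ := hx
    exact basis w
  | zero => exact zero
  | add x y _ _ hx hy => exact add x y hx hy
  | smul a x _ hx => exact smul a x hx

theorem repr_C_bar (h : Hecke L) (y : W) :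
    (C L).repr (bar L h) y = barA ((C L).repr h y) := by
  classical
  induction h using C_induction with
  | zero => rw [bar_zero, map_zero, Finsupp.zero_apply, map_zero]
  | basis w =>
    rw [bar_C, Module.Basis.repr_self, Finsupp.single_apply]
    split_ifs
    · rw [map_one]
    · rw [map_zero]
  | add h h' ih ih' =>
    rw [bar_add, map_add, Finsupp.add_apply, ih, ih', map_add, Finsupp.add_apply, map_add]
  | smul a h ih =>
    rw [bar_smul, map_smul, Finsupp.smul_apply, ih, map_smul, Finsupp.smul_apply, smul_eq_mul,
      smul_eq_mul, map_mul]

variable [Fintype W]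

theorem deg_hCoeff_le (x y z : W) : deg (hCoeff L x y z) ≤ ((aFun L z : Γ) : WithBot Γ) := by
  have h := Finset.le_sup (f := fun p : W × W => deg (hCoeff L p.1 p.2 z))
    (Finset.mem_univ ((x, y) : W × W))
  rw [aFun, WithBot.coe_unbot]
  exact h

theorem aFun_le {z : W} {γ : Γ} (h : ∀ x y, deg (hCoeff L x y z) ≤ (γ : WithBot Γ)) :
    aFun L z ≤ γ := by
  rw [← WithBot.coe_le_coe, aFun, WithBot.coe_unbot]
  exact Finset.sup_le fun p _ => h p.1 p.2

theorem aFun_inv (z : W) : aFun L z⁻¹ = aFun L z := by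
  apply le_antisymm <;> refine aFun_le L fun x y => ?_
  · have h := hCoeff_inv L x⁻¹ y⁻¹ z
    rw [inv_inv, inv_inv] at h
    rw [h]
    exact deg_hCoeff_le L _ _ _
  · rw [← hCoeff_inv L y x z]
    exact deg_hCoeff_le L _ _ _

theorem deg_pStar_one_le (h1 : P1 L) (z : W) : deg (pStar L 1 z) ≤ ((-aFun L z : Γ) : WithBot Γ) := by
  have h := h1 z
  unfold Delta at h
  -- When p*_{1,z} = 0, Δ(z) = +∞ and P₁ is vacuous, but the degree is then -∞.
  induction hd : deg (pStar L 1 z) with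
  | bot => exact bot_le
  | coe γ =>
    rw [hd] at h
    have h' : aFun L z ≤ -γ := WithTop.coe_le_coe.1 h
    exact WithBot.coe_le_coe.2 (le_neg_of_le_neg h')

variable {w₀ : W} (hw₀ : ∀ w : W, cs.length w ≤ cs.length w₀)
include hw₀

/-- Bar exchanges T_{w₀} with its inverse, so the conjugate stays bar-invariant because T_{w₀}² is
central. The degree condition survives because conjugation permutes the T_y. -/
theorem conj_longest_C (w : W) : T L w₀ * C L w * bar L (T L w₀) = C L (w₀ * w * w₀) := by
  have hT := bar_T_longest L hw₀
  apply eq_C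
  · have hc := (commute_T_longest_sq L hw₀ (C L w)).eq
    rw [bar_mul, bar_mul, bar_bar, bar_C, hT, ← TUnit_val L w₀, mul_assoc, Units.inv_mul_eq_iff_eq_mul,
      ← mul_assoc, ← mul_assoc, Units.eq_mul_inv_iff_mul_eq, TUnit_val, mul_assoc, hc]
  · intro y
    have hw : T L (w₀ * w * w₀) = T L w₀ * T L w * bar L (T L w₀) := by
      rw [T_longest_mul_T L hw₀, hT, mul_assoc (T L _), ← TUnit_val L w₀, Units.mul_inv, mul_one]
    rw [hw, ← sub_mul, ← mul_sub, ← longest_conj_conj cs hw₀ y, repr_conj_longest L hw₀]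
    exact deg_repr_C_sub L w _

theorem hCoeff_conj_longest (x y z : W) :
    hCoeff L (w₀ * x * w₀) (w₀ * y * w₀) (w₀ * z * w₀) = hCoeff L x y z := by
  classical
  have hT := bar_T_longest L hw₀
  have e : ∀ h, (C L).repr (T L w₀ * h * bar L (T L w₀)) (w₀ * z * w₀) = (C L).repr h z := by
    intro h
    induction h using C_induction with
    | zero => rw [mul_zero, zero_mul, map_zero, Finsupp.zero_apply, Finsupp.zero_apply]
    | basis w =>
      rw [conj_longest_C L hw₀, Module.Basis.repr_self, Module.Basis.repr_self,
        Finsupp.single_apply, Finsupp.single_apply]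
      simp
    | add h h' ih ih' =>
      rw [mul_add, add_mul, map_add, Finsupp.add_apply, ih, ih', map_add, Finsupp.add_apply]
    | smul a h ih =>
      rw [mul_smul_comm, smul_mul_assoc, map_smul, Finsupp.smul_apply, ih, map_smul,
        Finsupp.smul_apply]
  rw [hCoeff, hCoeff, ← e, ← conj_longest_C L hw₀, ← conj_longest_C L hw₀]
  congr 2
  rw [hT, ← TUnit_val L w₀]
  simp only [mul_assoc, Units.inv_mul_cancel_left]

theorem aFun_conj_longest (z : W) : aFun L (w₀ * z * w₀) = aFun L z := by
  have key : ∀ z, aFun L z ≤ aFun L (w₀ * z * w₀) := fun z => aFun_le L fun x y => by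
    rw [← hCoeff_conj_longest L hw₀]
    exact deg_hCoeff_le L _ _ _
  apply le_antisymm _ (key z)
  have h := key (w₀ * z * w₀)
  rwa [longest_conj_conj cs hw₀] at h

end KazhdanLusztig

end HeckeKL

namespace HeckeKL

/-! ### Dual bases and the reversal of ≤_L by w₀ -/

section Duality

variable {B W : Type*} [Group W] {M : CoxeterMatrix B} {cs : CoxeterSystem M W}
  {Γ : Type*} [AddCommGroup Γ] [LinearOrder Γ] [IsOrderedAddMonoid Γ] (L : WeightFunction cs Γ)

/-- Congruences to 0 or 1 modulo A_{<0} multiply, as they hold inside the ring A_{≤0} where A_{<0}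
is an ideal. -/
theorem deg_mul_sub_lt_zero {a b : Coeff Γ} {P Q : Prop} [Decidable P] [Decidable Q]
    (ha : deg (a - if P then 1 else 0) < 0) (hb : deg (b - if Q then 1 else 0) < 0) :
    deg (a * b - if P ∧ Q then 1 else 0) < 0 := by
  have hab : deg ((a - if P then 1 else 0) * (b - if Q then 1 else 0)) < 0 := by
    have h := deg_mul_lt_of_lt_of_le (α := 0) (β := 0) ha hb.le
    rwa [add_zero] at h
  by_cases hP : P <;> by_cases hQ : Q <;>
    simp only [hP, hQ, and_self, and_false, and_true, if_true, if_false, sub_zero] at ha hb hab ⊢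
  · have e : a * b - 1 = (a - 1) * (b - 1) + ((a - 1) + (b - 1)) := by ring
    rw [e]
    exact deg_add_lt_zero hab (deg_add_lt_zero ha hb)
  · have e : a * b = (a - 1) * b + b := by ring
    rw [e]
    exact deg_add_lt_zero hab hb
  · have e : a * b = a * (b - 1) + a := by ring
    rw [e]
    exact deg_add_lt_zero hab ha
  · exact hab

theorem deg_pStar_sub_lt_zero [DecidableEq W] (y w : W) :
    deg ((T L).repr (C L w) y - if y = w then 1 else 0) < 0 := by
  have h := deg_repr_C_sub L w y
  rw [map_sub, Finsupp.sub_apply, Module.Basis.repr_self, Finsupp.single_apply] at h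
  simpa only [eq_comm] using h

variable [Fintype W]

theorem repr_C_mul (h m : Hecke L) (x : W) :
    (C L).repr (h * m) x = ∑ z, (C L).repr m z * (C L).repr (h * C L z) x := by
  conv_lhs => rw [← (C L).sum_repr m, Finset.mul_sum]
  rw [map_sum, Finsupp.finsetSum_apply]
  refine Finset.sum_congr rfl fun z _ => ?_
  rw [mul_smul_comm, map_smul, Finsupp.smul_apply, smul_eq_mul]

theorem repr_C_mul_C (h : Hecke L) (x y : W) :
    (C L).repr (h * C L y) x = ∑ u, (C L).repr h u * hCoeff L u y x := by
  conv_lhs => rw [← (C L).sum_repr h, Finset.sum_mul]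
  rw [map_sum, Finsupp.finsetSum_apply]
  refine Finset.sum_congr rfl fun z _ => ?_
  rw [smul_mul_assoc, map_smul, Finsupp.smul_apply, smul_eq_mul, hCoeff]

/-- The span of the C_x with x ≤_L u is a left ideal: writing T_s = C_s - v^{-L(s)}, each generator
either keeps x or makes one step down. -/
theorem leL_of_repr_ne_zero {u : W} (h : Hecke L) {m : Hecke L}
    (hm : ∀ x, (C L).repr m x ≠ 0 → leL L x u) {x : W} (hx : (C L).repr (h * m) x ≠ 0) :
    leL L x u := by
  induction h using gen_induction generalizing x with
  | h1 =>
    rw [one_mul] at hx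
    exact hm x hx
  | hg i h ih =>
    have e : gen L i * h * m = C L (cs.simple i) * (h * m)
        - v (-L.toFun (cs.simple i)) • (h * m) := by
      rw [C_simple, add_mul, smul_mul_assoc, one_mul, add_sub_cancel_right, mul_assoc]
    rw [e, map_sub, Finsupp.sub_apply, map_smul, Finsupp.smul_apply, smul_eq_mul] at hx
    by_cases h0 : (C L).repr (h * m) x = 0
    · rw [h0, mul_zero, sub_zero, repr_C_mul] at hx
      obtain ⟨z, _, hz⟩ := Finset.exists_ne_zero_of_sum_ne_zero hx
      exact Relation.ReflTransGen.head ⟨i, right_ne_zero_of_mul hz⟩ (ih (left_ne_zero_of_mul hz))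
    · exact ih h0
  | hadd a b ha hb =>
    rw [add_mul, map_add, Finsupp.add_apply] at hx
    by_cases h0 : (C L).repr (a * m) x = 0
    · rw [h0, zero_add] at hx
      exact hb hx
    · exact ha h0
  | hsmul a b hb =>
    rw [smul_mul_assoc, map_smul, Finsupp.smul_apply, smul_eq_mul] at hx
    exact hb (right_ne_zero_of_mul hx)

theorem leL_of_repr_mul_C_ne_zero (h : Hecke L) {x u : W} (hx : (C L).repr (h * C L u) x ≠ 0) :
    leL L x u := by
  classical
  refine leL_of_repr_ne_zero L h (fun z hz => ?_) hx
  rw [Module.Basis.repr_self, Finsupp.single_apply] at hz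
  obtain rfl : u = z := by
    by_contra hne
    exact hz (if_neg hne)
  exact Relation.ReflTransGen.refl

theorem aFun_le_of_leL (h4 : P4 L) {x y : W} (h : leL L x y) : aFun L y ≤ aFun L x :=
  h4 y x (Relation.ReflTransGen.mono (fun _ _ => Or.inl) _ _ h)

variable {w₀ : W} (hw₀ : ∀ w : W, cs.length w ≤ cs.length w₀)
include hw₀

/-- Two semilinear maps compose to a linear one, so h' may be taken to be T_b. Then bar(T_b)T_{w₀} =
T_{bw₀} and the trace form pick out one coefficient of h. -/
theorem repr_mul_bar_signBar (h h' : Hecke L) : (T L).repr (h * bar L (signBar L h')) w₀ =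
    ∑ b, (-1) ^ cs.length b * (T L).repr h' b * (T L).repr h (w₀ * b⁻¹) := by
  classical
  induction h' using hecke_induction with
  | h0 => simp [signBar_zero, bar_zero]
  | hadd x y hx hy =>
    rw [signBar_add, bar_add, mul_add, map_add, Finsupp.add_apply, hx, hy,
      ← Finset.sum_add_distrib]
    refine Finset.sum_congr rfl fun b _ => ?_
    rw [map_add, Finsupp.add_apply, mul_add, add_mul]
  | hsmul a x hx =>
    rw [signBar_smul, bar_smul, barA_barA, mul_smul_comm, map_smul, Finsupp.smul_apply, hx,
      Finset.smul_sum]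
    refine Finset.sum_congr rfl fun b _ => ?_
    rw [map_smul, Finsupp.smul_apply, smul_eq_mul, smul_eq_mul]
    ring
  | hT w =>
    rw [Finset.sum_eq_single w]
    · rw [signBar_T, bar_smul, barA_neg_one_pow, mul_smul_comm, map_smul, Finsupp.smul_apply,
        smul_eq_mul, Module.Basis.repr_self, Finsupp.single_eq_same, mul_one,
        ← repr_mul_T_longest L hw₀, mul_assoc, bar_T_mul_T_longest L hw₀]
      congr 1
      induction h using hecke_induction with
      | h0 => simp
      | hadd x y hx hy => rw [add_mul, map_add, map_add, Finsupp.add_apply, hx, hy,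
          Finsupp.add_apply]
      | hsmul a x hx => rw [smul_mul_assoc, map_smul, map_smul, Finsupp.smul_apply, hx,
          Finsupp.smul_apply]
      | hT u =>
        rw [repr_T_mul_T_one, Module.Basis.repr_self, Finsupp.single_apply]
        simp only [mul_eq_one_iff_eq_inv, mul_inv_rev, longest_inv cs hw₀]
    · intro b _ hb
      rw [Module.Basis.repr_self, Finsupp.single_eq_of_ne hb, mul_zero, zero_mul]
    · intro hn
      exact absurd (Finset.mem_univ w) hn

/-- The bases `C_w` and `(-1) ^ ℓ(w) signBar C_w` are dual to each other, up to `w₀`. -/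
theorem repr_C_mul_signBar_C [DecidableEq W] (x w : W) :
    (T L).repr (C L x * signBar L (C L w)) w₀
      = if w₀ * w⁻¹ = x then (-1) ^ cs.length w else 0 := by
  rw [← sub_eq_zero]
  -- Both factors are bar-invariant, hence so is the coefficient at w₀. Its expansion in the p*
  -- agrees with the right-hand side modulo A_{<0}, and a bar-invariant element of A_{<0} vanishes.
  apply eq_zero_of_bar
  · rw [map_sub, ← repr_bar_longest L hw₀, bar_mul, bar_C, bar_signBar_C, apply_ite barA,
      barA_neg_one_pow, map_zero]
  · rw [← bar_signBar_C, repr_mul_bar_signBar L hw₀]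
    have e : (if w₀ * w⁻¹ = x then (-1) ^ cs.length w else 0 : Coeff Γ) =
        ∑ b, (-1) ^ cs.length b * if b = w ∧ w₀ * b⁻¹ = x then 1 else 0 := by
      rw [Finset.sum_eq_single w]
      · simp
      · intro b _ hb
        simp [hb]
      · intro hn
        exact absurd (Finset.mem_univ w) hn
    rw [e, ← Finset.sum_sub_distrib]
    refine deg_sum_lt (γ := 0) fun b _ => ?_
    rw [mul_assoc, ← mul_sub, deg_neg_one_pow_mul]
    exact deg_mul_sub_lt_zero (deg_pStar_sub_lt_zero L b w) (deg_pStar_sub_lt_zero L _ x)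

theorem repr_mul_signBar_C (h : Hecke L) (x : W) :
    (T L).repr (h * signBar L (C L (x⁻¹ * w₀))) w₀
      = (-1) ^ cs.length (x⁻¹ * w₀) * (C L).repr h x := by
  classical
  induction h using C_induction with
  | zero => simp
  | add a b ha hb => rw [add_mul, map_add, Finsupp.add_apply, ha, hb, map_add, Finsupp.add_apply,
      mul_add]
  | smul a b hb =>
    rw [smul_mul_assoc, map_smul, Finsupp.smul_apply, hb, map_smul, Finsupp.smul_apply,
      smul_eq_mul, smul_eq_mul, mul_left_comm]
  | basis y =>
    rw [repr_C_mul_signBar_C L hw₀, Module.Basis.repr_self, Finsupp.single_apply, mul_inv_rev,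
      inv_inv, mul_inv_cancel_left]
    simp only [mul_ite, mul_one, mul_zero, eq_comm]

/-- The coefficients of `T_{w₀}` in the Kazhdan–Lusztig basis. -/
theorem repr_C_T_longest (u : W) : (-1) ^ cs.length (u⁻¹ * w₀) * (C L).repr (T L w₀) u
    = pStar L 1 (u⁻¹ * w₀) := by
  classical
  -- Pairing with the dual basis extracts the coefficient of C_u; T_{w₀} has coefficient 0 at w₀b⁻¹
  -- unless b = 1.
  rw [← repr_mul_signBar_C L hw₀, ← bar_signBar_C, repr_mul_bar_signBar L hw₀,
    Finset.sum_eq_single 1]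
  · simp [pStar]
  · intro b _ hb
    rw [Module.Basis.repr_self, Finsupp.single_eq_of_ne, mul_zero]
    simpa using hb
  · intro hn
    exact absurd (Finset.mem_univ _) hn

/-- The composite of `flat`, `bar` and `signBar` is a linear anti-automorphism φ with φ(T_w) =
±T_w⁻¹. It only changes the coefficient at w₀ by a sign, and it sends the product pairing hC_y with
the dual of C_x to one of the same shape, with w₀x and w₀y exchanged. -/
theorem repr_mul_C_duality {h g : Hecke L}
    (hg : T L w₀ * g = flat L (bar L (signBar L h)) * T L w₀) (x y : W) :
    ∃ k : ℕ, (C L).repr (h * C L y) x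
      = (-1) ^ k * (C L).repr (g * C L (w₀ * x)) (w₀ * y) := by
  have hinv := longest_inv cs hw₀
  set m := h * C L y * signBar L (C L (x⁻¹ * w₀)) with hm
  have h1 : (T L).repr (flat L (bar L (signBar L m))) w₀
      = (-1) ^ cs.length w₀ * (T L).repr m w₀ := by
    rw [repr_flat, hinv, repr_bar_longest L hw₀, repr_signBar, map_mul, barA_neg_one_pow,
      barA_barA]
  have h2 : flat L (bar L (signBar L m)) = C L (w₀ * x) *
      (signBar L (C L y⁻¹) * flat L (bar L (signBar L h))) := by
    rw [hm, signBar_mul, signBar_mul, signBar_signBar, bar_mul, bar_mul, bar_C, bar_signBar_C,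
      flat_mul, flat_mul, flat_C, ← signBar_flat, flat_C, mul_inv_rev, inv_inv, hinv]
  -- Multiplying by T_{w₀} turns the coefficient at w₀ into a trace. There φ(h)T_{w₀} becomes
  -- T_{w₀}g, and cyclic rotation brings g to the front.
  have h3 : (T L).repr (flat L (bar L (signBar L m))) w₀ =
      (T L).repr (g * C L (w₀ * x) * signBar L (C L ((w₀ * y)⁻¹ * w₀))) w₀ := by
    rw [h2, ← repr_mul_T_longest L hw₀, ← repr_mul_T_longest L hw₀, mul_assoc, mul_assoc, ← hg,
      ← mul_assoc, repr_mul_comm_one, mul_assoc, repr_mul_comm_one, mul_inv_rev, mul_assoc y⁻¹,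
      inv_mul_cancel, mul_one]
    simp only [mul_assoc]
  rw [h1, repr_mul_signBar_C L hw₀, repr_mul_signBar_C L hw₀] at h3
  have hs : ∀ k : ℕ, ((-1) ^ k * (-1) ^ k : Coeff Γ) = 1 := fun k => by
    rw [← mul_pow, neg_one_mul, neg_neg, one_pow]
  refine ⟨cs.length (x⁻¹ * w₀) + cs.length w₀ + cs.length ((w₀ * y)⁻¹ * w₀), ?_⟩
  rw [pow_add, mul_assoc, ← h3, pow_add, mul_assoc, ← mul_assoc ((-1) ^ cs.length w₀), hs, one_mul,
    ← mul_assoc, hs, one_mul]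

theorem leL_longest_mul_of_leftStep {x y : W} (h : leftStep L x y) :
    leL L (w₀ * y) (w₀ * x) := by
  classical
  by_cases hxy : x = y
  · rw [hxy]
    exact Relation.ReflTransGen.refl
  obtain ⟨i, hi⟩ := h
  obtain ⟨j, hj⟩ := exists_longest_conj_simple cs hw₀ i
  have hj' : w₀ * cs.simple j * w₀ = cs.simple i := by
    rw [← hj, longest_conj_conj cs hw₀]
  -- φ(C_s) = -T_s + v^{L(s)}, and carrying T_{w₀} across replaces s by w₀sw₀.
  have hg : T L w₀ * (-gen L j + v (L.toFun (cs.simple i)) • 1)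
      = flat L (bar L (signBar L (C L (cs.simple i)))) * T L w₀ := by
    have e : flat L (bar L (signBar L (C L (cs.simple i))))
        = -gen L i + v (L.toFun (cs.simple i)) • 1 := by
      rw [bar_signBar_C, C_simple, signBar_add, signBar_gen, signBar_smul, signBar_one, barA_v,
        neg_neg, map_add, map_neg, flat_gen, map_smul, flat_one]
    have e2 := T_longest_mul_T L hw₀ (cs.simple j)
    rw [hj', T_simple, T_simple] at e2
    rw [e, mul_add, add_mul, mul_smul_comm, smul_mul_assoc, mul_one, one_mul]
    congr 1
    exact (mul_neg _ _).trans ((congrArg Neg.neg e2).trans (neg_mul _ _).symm)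
  obtain ⟨k, hk⟩ := repr_mul_C_duality L hw₀ hg x y
  have h0 : (C L).repr ((-gen L j + v (L.toFun (cs.simple i)) • 1) * C L (w₀ * x)) (w₀ * y)
      ≠ 0 := by
    intro h0
    rw [h0, mul_zero] at hk
    exact hi hk
  exact leL_of_repr_mul_C_ne_zero L _ h0

theorem leL_longest_mul {x y : W} (h : leL L x y) : leL L (w₀ * y) (w₀ * x) := by
  induction h with
  | refl => exact Relation.ReflTransGen.refl
  | tail _ hs ih => exact (leL_longest_mul_of_leftStep L hw₀ hs).trans ih

theorem leL_longest_mul_iff {x y : W} : leL L (w₀ * y) (w₀ * x) ↔ leL L x y := by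
  refine ⟨fun h => ?_, leL_longest_mul L hw₀⟩
  have := leL_longest_mul L hw₀ h
  rwa [longest_mul_longest_mul cs hw₀, longest_mul_longest_mul cs hw₀] at this

/-- Only x⁻¹ ≤_L u⁻¹ is available, as u is the left factor. Reversal by w₀ and P₄ compare a(w₀x⁻¹)
with a(w₀u⁻¹); invariance of a under inversion and w₀-conjugation gives the stated form. -/
theorem aFun_longest_mul_le (h4 : P4 L) {u x y : W} (h : hCoeff L u y x ≠ 0) :
    aFun L (w₀ * x) ≤ aFun L (u⁻¹ * w₀) := by
  have h1 : leL L x⁻¹ u⁻¹ := by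
    apply leL_of_repr_mul_C_ne_zero L (C L y⁻¹)
    rw [← hCoeff, hCoeff_inv]
    exact h
  have h2 := aFun_le_of_leL L h4 (leL_longest_mul L hw₀ h1)
  rw [← aFun_inv, ← aFun_conj_longest L hw₀ (w₀ * u⁻¹), longest_mul_longest_mul cs hw₀,
    mul_inv_rev, inv_inv, longest_inv cs hw₀, ← aFun_conj_longest L hw₀, mul_assoc w₀, mul_assoc x,
    longest_mul_self cs hw₀, mul_one] at h2
  exact h2

end Duality

end HeckeKL

namespace HeckeKL

/-! ### Powers of T_{w₀} in the Kazhdan–Lusztig basis -/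

section LongestPowers

variable {B W : Type*} [Group W] [Fintype W] {M : CoxeterMatrix B} {cs : CoxeterSystem M W}
  {Γ : Type*} [AddCommGroup Γ] [LinearOrder Γ] [IsOrderedAddMonoid Γ] (L : WeightFunction cs Γ)

section Augmentation

/-- The kernel of the specialization `v ^ γ ↦ 1` on the Hecke algebra. -/
noncomputable def augSubmodule : Submodule (Coeff Γ) (Hecke L) :=
  RingHom.ker (augmentation Γ) • (⊤ : Submodule (Coeff Γ) (Hecke L))

theorem mul_mem_augSubmodule (a : Hecke L) {h : Hecke L} (hh : h ∈ augSubmodule L) :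
    a * h ∈ augSubmodule L := by
  induction hh using Submodule.smul_induction_on' with
  | smul r hr n _ =>
    rw [mul_smul_comm]
    exact Submodule.smul_mem_smul hr trivial
  | add x _ y _ hx hy =>
    rw [mul_add]
    exact Submodule.add_mem _ hx hy

theorem mem_augSubmodule_mul (a : Hecke L) {h : Hecke L} (hh : h ∈ augSubmodule L) :
    h * a ∈ augSubmodule L := by
  induction hh using Submodule.smul_induction_on' with
  | smul r hr n _ =>
    rw [smul_mul_assoc]
    exact Submodule.smul_mem_smul hr trivial
  | add x _ y _ hx hy =>
    rw [add_mul]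
    exact Submodule.add_mem _ hx hy

theorem augmentation_repr_eq_zero {h : Hecke L} (hh : h ∈ augSubmodule L) (x : W) :
    augmentation Γ ((C L).repr h x) = 0 := by
  induction hh using Submodule.smul_induction_on' with
  | smul r hr n _ =>
    rw [map_smul, Finsupp.smul_apply, smul_eq_mul, map_mul, RingHom.mem_ker.1 hr, zero_mul]
  | add x _ y _ hx hy => rw [map_add, Finsupp.add_apply, map_add, hx, hy, add_zero]

/-- At v = 1 the parameters v^{L(s)} - v^{-L(s)} vanish and the Hecke algebra becomes the group ring
of W. -/
theorem T_mul_T_sub_mem_augSubmodule (a b : W) :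
    T L a * T L b - T L (a * b) ∈ augSubmodule L := by
  induction a using length_induction cs with
  | one =>
    rw [T_one, one_mul, one_mul, sub_self]
    exact Submodule.zero_mem _
  | step i u hu ih =>
    have h1 : gen L i * T L (u * b) - T L (cs.simple i * (u * b)) ∈ augSubmodule L := by
      rw [gen_mul_T, add_sub_cancel_left]
      split_ifs
      · refine Submodule.smul_mem_smul ?_ trivial
        rw [RingHom.mem_ker, param, map_sub, augmentation_v, augmentation_v, sub_self]
      · exact Submodule.zero_mem _
    have h2 := Submodule.add_mem _ (mul_mem_augSubmodule L (gen L i) ih) h1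
    rwa [mul_sub, sub_add_sub_cancel, ← mul_assoc, gen_mul_T_up L hu, ← mul_assoc] at h2

theorem pow_sub_one_mem_augSubmodule {h : Hecke L} (hh : h - 1 ∈ augSubmodule L) (k : ℕ) :
    h ^ k - 1 ∈ augSubmodule L := by
  induction k with
  | zero =>
    rw [pow_zero, sub_self]
    exact Submodule.zero_mem _
  | succ k ih =>
    have := Submodule.add_mem _ (mul_mem_augSubmodule L (h ^ k) hh) ih
    rwa [mul_sub, mul_one, sub_add_sub_cancel, ← pow_succ] at this

end Augmentation

/-- The first bound kills the exponents above γ, the second those below. -/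
theorem eq_single_of_deg_le {a : Coeff Γ} {γ : Γ} (h : deg a ≤ (γ : WithBot Γ))
    (h' : deg (barA a) ≤ ((-γ : Γ) : WithBot Γ)) :
    a = AddMonoidAlgebra.single γ (augmentation Γ a) := by
  have e : a = AddMonoidAlgebra.single γ (a.coeff γ) := by
    ext δ
    rcases lt_trichotomy δ γ with hlt | rfl | hlt
    · have := deg_le_iff.1 h' (-δ) (neg_lt_neg hlt)
      rw [barA_coeff, neg_neg] at this
      simp [this, hlt.ne']
    · simp
    · simp [deg_le_iff.1 h δ hlt, hlt.ne]
  rw [e, augmentation_single]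

theorem lam_natCast (w₀ : W) (n : ℕ) (x y : W) :
    lam L w₀ n x y = (C L).repr (T L w₀ ^ n * C L y) x := by
  rw [lam, zpow_natCast, Units.val_pow_eq_pow_val, TUnit_val]

theorem lam_zero [DecidableEq W] (w₀ x y : W) : lam L w₀ 0 x y = if x = y then 1 else 0 := by
  rw [lam, zpow_zero, Units.val_one, one_mul, Module.Basis.repr_self, Finsupp.single_apply]
  simp only [eq_comm]

theorem leL_of_lam_ne_zero {w₀ : W} {n : ℤ} {x y : W} (h : lam L w₀ n x y ≠ 0) : leL L x y :=
  leL_of_repr_mul_C_ne_zero L _ h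

theorem lam_succ (w₀ : W) (n : ℕ) (x y : W) :
    lam L w₀ (n + 1 : ℕ) x y = ∑ z, lam L w₀ n z y * lam L w₀ (1 : ℕ) x z := by
  simp only [lam_natCast]
  rw [pow_succ', mul_assoc, repr_C_mul]
  simp only [pow_one]

variable {w₀ : W} (hw₀ : ∀ w : W, cs.length w ≤ cs.length w₀)
include hw₀

theorem lam_neg_natCast (n : ℕ) (x y : W) :
    lam L w₀ (-n) x y = (C L).repr (bar L (T L w₀) ^ n * C L y) x := by
  rw [lam, zpow_neg, zpow_natCast, ← inv_pow, Units.val_pow_eq_pow_val, bar_T_longest L hw₀]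

theorem lam_neg (n : ℕ) (x y : W) : lam L w₀ (-n) x y = barA (lam L w₀ n x y) := by
  rw [lam_neg_natCast L hw₀, lam_natCast, ← repr_C_bar, bar_mul, bar_pow, bar_C]

/-- Duality for h = T_{w₀}^n: here φ(h) = ±T_{w₀}^{-n} commutes with T_{w₀}, so g = φ(h) is allowed.
-/
theorem deg_lam_neg (n : ℕ) (x y : W) :
    deg (lam L w₀ (-n) x y) = deg (lam L w₀ n (w₀ * y) (w₀ * x)) := by
  have hc : T L w₀ * bar L (T L w₀) ^ n = bar L (T L w₀) ^ n * T L w₀ := by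
    rw [bar_T_longest L hw₀, ← TUnit_val L w₀, ← Units.val_pow_eq_pow_val, ← Units.val_mul,
      ← Units.val_mul]
    congr 1
    exact ((Commute.refl (TUnit L w₀)).inv_right.pow_right n).eq
  have hf : flat L (bar L (signBar L (T L w₀ ^ n)))
      = (((-1) ^ cs.length w₀) ^ n : Coeff Γ) • bar L (T L w₀) ^ n := by
    rw [signBar_pow, signBar_T, smul_pow, bar_smul, bar_pow, map_smul, flat_pow, ← bar_flat, flat_T,
      longest_inv cs hw₀, map_pow, barA_neg_one_pow]
  have hg : T L w₀ * ((((-1) ^ cs.length w₀) ^ n : Coeff Γ) • bar L (T L w₀) ^ n)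
      = flat L (bar L (signBar L (T L w₀ ^ n))) * T L w₀ := by
    rw [hf, mul_smul_comm, hc, smul_mul_assoc]
  obtain ⟨k, hk⟩ := repr_mul_C_duality L hw₀ hg (w₀ * y) (w₀ * x)
  rw [longest_mul_longest_mul cs hw₀, longest_mul_longest_mul cs hw₀] at hk
  rw [lam_natCast, hk, deg_neg_one_pow_mul, smul_mul_assoc, map_smul, Finsupp.smul_apply,
    smul_eq_mul, ← pow_mul, deg_neg_one_pow_mul, lam_neg_natCast L hw₀]

theorem deg_lam_one (h1 : P1 L) (h4 : P4 L) (h8 : P8 L) (x y : W) :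
    deg (lam L w₀ (1 : ℕ) x y) ≤ ((aFun L x - aFun L (w₀ * x) : Γ) : WithBot Γ) ∧
    (¬ simL L x y →
      deg (lam L w₀ (1 : ℕ) x y) < ((aFun L x - aFun L (w₀ * x) : Γ) : WithBot Γ)) := by
  have hu : ∀ u, hCoeff L u y x ≠ 0 →
      deg ((C L).repr (T L w₀) u) ≤ ((-aFun L (w₀ * x) : Γ) : WithBot Γ) := fun u hu => by
    rw [← deg_neg_one_pow_mul, repr_C_T_longest L hw₀]
    exact (deg_pStar_one_le L h1 _).trans
      (WithBot.coe_le_coe.2 (neg_le_neg (aFun_longest_mul_le L hw₀ h4 hu)))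
  rw [lam_natCast, pow_one, repr_C_mul_C, sub_eq_neg_add]
  constructor
  · refine deg_sum_le fun u _ => ?_
    by_cases h0 : hCoeff L u y x = 0
    · rw [h0, mul_zero, deg_zero]
      exact bot_le
    · exact deg_mul_le (hu u h0) (deg_hCoeff_le L u y x)
  · intro hs
    refine deg_sum_lt fun u _ => ?_
    by_cases h0 : hCoeff L u y x = 0
    · rw [h0, mul_zero, deg_zero]
      exact WithBot.bot_lt_coe _
    · refine deg_mul_lt_of_le_of_lt (hu u h0)
        (deg_lt_of_coeff_eq_zero (deg_hCoeff_le L u y x) ?_)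
      by_contra hne
      -- The coefficient of v^{a(x)} in h_{u,y,x} is γ_{u,y,x⁻¹}; the middle relation of P₈ then
      -- reads y ∼_L x.
      have h := (h8 u y x⁻¹ (by rwa [gammaCoeff, inv_inv])).2.1
      rw [inv_inv] at h
      exact hs ⟨h.2, h.1⟩

theorem deg_lam_natCast (h1 : P1 L) (h4 : P4 L) (h8 : P8 L) (n : ℕ) (x y : W) :
    deg (lam L w₀ n x y) ≤ ((n • (aFun L x - aFun L (w₀ * x)) : Γ) : WithBot Γ) ∧
    (¬ simL L x y →
      deg (lam L w₀ n x y) < ((n • (aFun L x - aFun L (w₀ * x)) : Γ) : WithBot Γ)) := by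
  classical
  induction n generalizing x y with
  | zero =>
    rw [zero_nsmul, Nat.cast_zero, lam_zero]
    constructor
    · split_ifs
      · exact (deg_v (0 : Γ)).le
      · rw [deg_zero]
        exact bot_le
    · intro hs
      rw [if_neg, deg_zero]
      · exact WithBot.bot_lt_coe _
      · rintro rfl
        exact hs ⟨Relation.ReflTransGen.refl, Relation.ReflTransGen.refl⟩
  | succ n ih =>
    -- From x ≤_L z, P₄ gives a(z) ≤ a(x), and after reversal by w₀ also a(w₀x) ≤ a(w₀z).
    have key : ∀ z, leL L x z → n • (aFun L z - aFun L (w₀ * z))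
        ≤ n • (aFun L x - aFun L (w₀ * x)) := fun z hz =>
      nsmul_le_nsmul_right (sub_le_sub (aFun_le_of_leL L h4 hz)
        (aFun_le_of_leL L h4 (leL_longest_mul L hw₀ hz))) n
    rw [lam_succ, succ_nsmul]
    constructor
    · refine deg_sum_le fun z _ => ?_
      by_cases h0 : lam L w₀ (1 : ℕ) x z = 0
      · rw [h0, mul_zero, deg_zero]
        exact bot_le
      · exact deg_mul_le ((ih z y).1.trans (WithBot.coe_le_coe.2 (key z (leL_of_lam_ne_zero L h0))))
          (deg_lam_one L hw₀ h1 h4 h8 x z).1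
    · intro hs
      refine deg_sum_lt fun z _ => ?_
      by_cases h0 : lam L w₀ (1 : ℕ) x z = 0
      · rw [h0, mul_zero, deg_zero]
        exact WithBot.bot_lt_coe _
      have hk := WithBot.coe_le_coe.2 (key z (leL_of_lam_ne_zero L h0))
      -- As x and y lie in different left cells, at least one of the two factors joins different
      -- cells and is strictly bounded.
      by_cases hxz : simL L x z
      · have hzy : ¬ simL L z y := fun h =>
          hs ⟨hxz.1.trans h.1, h.2.trans hxz.2⟩
        exact deg_mul_lt_of_lt_of_le (((ih z y).2 hzy).trans_le hk) (deg_lam_one L hw₀ h1 h4 h8 x z).1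
      · exact deg_mul_lt_of_le_of_lt ((ih z y).1.trans hk) ((deg_lam_one L hw₀ h1 h4 h8 x z).2 hxz)

theorem deg_lam_neg_natCast (h1 : P1 L) (h4 : P4 L) (h8 : P8 L) (n : ℕ) (x y : W) :
    deg (lam L w₀ (-n) x y) ≤ ((-(n • (aFun L y - aFun L (w₀ * y))) : Γ) : WithBot Γ) ∧
    (¬ simL L x y →
      deg (lam L w₀ (-n) x y) < ((-(n • (aFun L y - aFun L (w₀ * y))) : Γ) : WithBot Γ)) := by
  have h := deg_lam_natCast L hw₀ h1 h4 h8 n (w₀ * y) (w₀ * x)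
  rw [longest_mul_longest_mul cs hw₀, ← deg_lam_neg L hw₀] at h
  rw [← smul_neg, neg_sub]
  refine ⟨h.1, fun hs => h.2 fun hs' => hs ?_⟩
  exact ⟨(leL_longest_mul_iff L hw₀).1 hs'.1, (leL_longest_mul_iff L hw₀).1 hs'.2⟩

theorem augmentation_lam_of_even [DecidableEq W] {n : ℕ} (hn : Even n) (x y : W) :
    augmentation Γ (lam L w₀ n x y) = if x = y then 1 else 0 := by
  obtain ⟨k, rfl⟩ := hn
  have hsq : T L w₀ * T L w₀ - 1 ∈ augSubmodule L := by
    have := T_mul_T_sub_mem_augSubmodule L w₀ w₀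
    rwa [longest_mul_self cs hw₀, T_one] at this
  have h := augmentation_repr_eq_zero L
    (mem_augSubmodule_mul L (C L y) (pow_sub_one_mem_augSubmodule L hsq k)) x
  rw [sub_mul, one_mul, map_sub, Finsupp.sub_apply, map_sub, sub_eq_zero, ← sq, ← pow_mul, two_mul,
    ← lam_natCast, Module.Basis.repr_self, Finsupp.single_apply] at h
  rw [h, apply_ite (augmentation Γ), map_one, map_zero]
  simp only [eq_comm]

theorem lam_natCast_of_even [DecidableEq W] (h1 : P1 L) (h4 : P4 L) (h8 : P8 L) {n : ℕ}
    (hn : Even n) {x y : W} (hs : simL L x y) :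
    lam L w₀ n x y = if x = y then v (n • (aFun L x - aFun L (w₀ * x))) else 0 := by
  have ha : aFun L x = aFun L y :=
    le_antisymm (aFun_le_of_leL L h4 hs.2) (aFun_le_of_leL L h4 hs.1)
  have ha' : aFun L (w₀ * x) = aFun L (w₀ * y) :=
    le_antisymm (aFun_le_of_leL L h4 (leL_longest_mul L hw₀ hs.1))
      (aFun_le_of_leL L h4 (leL_longest_mul L hw₀ hs.2))
  have hb := (deg_lam_neg_natCast L hw₀ h1 h4 h8 n x y).1
  -- The bound for -n involves y; constancy of both functions on the cell restates it at x, as the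
  -- exact opposite of the bound for n.
  rw [lam_neg L hw₀, ← ha, ← ha'] at hb
  rw [eq_single_of_deg_le (deg_lam_natCast L hw₀ h1 h4 h8 n x y).1 hb,
    augmentation_lam_of_even L hw₀ hn]
  split_ifs
  · rfl
  · exact AddMonoidAlgebra.single_zero _

end LongestPowers

end HeckeKL
/-- Here `a = aFun L`, `<_L` is `ltL L`, `∼_L` is `simL L`, and `λ^{(n)}_{x,y} = lam L w₀ n x y`. -/
theorem proposition1p2 {B W : Type*} [Group W] [Fintype W] [DecidableEq W]
    {M : CoxeterMatrix B} {cs : CoxeterSystem M W}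
    {Γ : Type*} [AddCommGroup Γ] [LinearOrder Γ] [IsOrderedAddMonoid Γ]
    (L : HeckeKL.WeightFunction cs Γ)
    (w₀ : W) (hw₀ : ∀ w : W, cs.length w ≤ cs.length w₀)
    (h1 : HeckeKL.P1 L) (h4 : HeckeKL.P4 L) (h8 : HeckeKL.P8 L)
    (n : ℤ) (x y : W) :
    (0 ≤ n →
      HeckeKL.deg (HeckeKL.lam L w₀ n x y) ≤
          ((n • (HeckeKL.aFun L x - HeckeKL.aFun L (w₀ * x)) : Γ) : WithBot Γ) ∧
        (HeckeKL.ltL L x y → HeckeKL.deg (HeckeKL.lam L w₀ n x y) <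
          ((n • (HeckeKL.aFun L x - HeckeKL.aFun L (w₀ * x)) : Γ) : WithBot Γ))) ∧
    (n ≤ 0 →
      HeckeKL.deg (HeckeKL.lam L w₀ n x y) ≤
          ((n • (HeckeKL.aFun L y - HeckeKL.aFun L (w₀ * y)) : Γ) : WithBot Γ) ∧
        (HeckeKL.ltL L x y → HeckeKL.deg (HeckeKL.lam L w₀ n x y) <
          ((n • (HeckeKL.aFun L y - HeckeKL.aFun L (w₀ * y)) : Γ) : WithBot Γ))) ∧
    (Even n → HeckeKL.simL L x y →
      HeckeKL.lam L w₀ n x y =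
        if x = y then HeckeKL.v (n • (HeckeKL.aFun L x - HeckeKL.aFun L (w₀ * x))) else 0) := by

  obtain ⟨m, rfl | rfl⟩ := n.eq_nat_or_neg
  · have hA := HeckeKL.deg_lam_natCast L hw₀ h1 h4 h8 m x y
    rw [natCast_zsmul, natCast_zsmul]
    refine ⟨fun _ => ⟨hA.1, fun h => hA.2 h.2⟩, fun hm => ?_, fun he hs => ?_⟩
    -- n = 0 is the only exponent to which both sign conditions apply, and there the two bounds
    -- coincide.
    · obtain rfl : m = 0 := by omega
      rw [zero_nsmul] at hA ⊢
      exact ⟨hA.1, fun h => hA.2 h.2⟩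
    · exact HeckeKL.lam_natCast_of_even L hw₀ h1 h4 h8 ((Int.even_coe_nat m).1 he) hs
  · have hA := HeckeKL.deg_lam_neg_natCast L hw₀ h1 h4 h8 m x y
    rw [neg_zsmul, neg_zsmul, natCast_zsmul, natCast_zsmul]
    refine ⟨fun hm => ?_, fun _ => ⟨hA.1, fun h => hA.2 h.2⟩, fun he hs => ?_⟩
    · obtain rfl : m = 0 := by omega
      rw [zero_nsmul] at hA ⊢
      exact ⟨hA.1, fun h => hA.2 h.2⟩
    · have he' : Even m := (Int.even_coe_nat m).1 (even_neg.1 he)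
      -- Negative even powers follow by bar conjugation, which negates the exponent of the monomial.
      rw [HeckeKL.lam_neg L hw₀, HeckeKL.lam_natCast_of_even L hw₀ h1 h4 h8 he' hs,
        apply_ite HeckeKL.barA, HeckeKL.barA_v, map_zero]
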